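/- \textbf{Conventions.} Algorithms are deterministic multi-tape (multi-stack) Turing machines. Variables and set elements are named by binary words, and every instance is written out explicitly as a word; $L$ denotes the length of that word. An algorithm decides a problem \emph{in time $2^{o(m)}$}, where $m$ is a size parameter of the instance, if there are a function $f:\mathbb N\to\mathbb R$ with $f(m)=o(m)$ as $m\to\infty$ and a polynomial $p$ such that on every instance it halts with the correct answer after at most $2^{f(m)}\,p(L)$ steps. \textbf{Problems.} \begin{itemize} \item \emph{3-SAT.} Input: a Boolean formula in 3CNF with $m$ clauses, each having exactly three (distinct) literals. Question: is it satisfiable? \item \emph{3-dimensional matching (3DM).} Input: finite sets $W,X,Y$ and a set $M\subseteq W\times X\times Y$ with $|M|=m$. Question: is there $M'\subseteq M$ such that each element of $W$, of $X$ and of $Y$ appears in exactly one triple of $M'$? \item \emph{Exact cover by 3-sets (X3C).} Input: a finite set $U$ whose number of elements is a multiple of $3$, and a collection $S=\{S_1,\dots,S_m\}$ of $m$ subsets of $U$, each with exactly three elements. Question: is there $S'\subseteq S$ such that each element of $U$ belongs to exactly one member of $S'$? \end{itemize} \textbf{Exponential time hypothesis (ETH).} No algorithm decides 3-SAT in time $2^{o(m)}$,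 where $m$ is the number of clauses. \textbf{Theorem.} If ETH holds, then no algorithm decides 3DM in time $2^{o(m)}$, where $m=|M|$ is the number of matches, and no algorithm decides X3C in time $2^{o(m)}$, where $m=|S|$ is the number of 3-sets. -/

import Mathlib

namespace SubexpTime

/-- The input alphabet: two bits and two separators. -/
inductive Symbol where
  | bit (b : Bool)
  | comma
  | semicolon
  deriving DecidableEq, Fintype

/-! ### Algorithms and their running time -/

/-- An algorithm: a multi-stack Turing machine with finite control that reads a word over `Symbol`
from its input stack and leaves a word over `Bool` on its output stack. -/
abbrev Algorithm := Turing.TM2ComputableAux Symbol Bool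

/-- Started on the input word `w`, the algorithm `A` halts after at most `t` steps of its machine
and its output is the one-letter word `b`. -/
def Algorithm.AnswersWithin (A : Algorithm) (w : List Symbol) (b : Bool) (t : ℕ) : Prop :=
  Nonempty (Turing.TM2OutputsInTime A.tm (w.map A.inputAlphabet.symm)
    (some ([b].map A.outputAlphabet.symm)) t)

/-- A decision problem: instances, their encoding as words, the size parameter `m` in which
running times are measured, and the set of YES-instances. -/
structure DecisionProblem where
  Instance : Type
  encode : Instance → List Symbol
  size : Instance → ℕ
  IsYes : Instance → Prop

/-- On every instance `x` the algorithm `A` halts with the correct answer, after at most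
`T x` steps. -/
def DecisionProblem.DecidedInTime (P : DecisionProblem) (A : Algorithm) (T : P.Instance → ℝ) :
    Prop :=
  ∀ x : P.Instance, ∃ (b : Bool) (t : ℕ),
    (b = true ↔ P.IsYes x) ∧ (t : ℝ) ≤ T x ∧ A.AnswersWithin (P.encode x) b t

/-- Some algorithm decides `P` in time `2 ^ o(m)`, where `m` is the size parameter of the instance
and where, as usual, a factor polynomial in the length of the input word is not counted. -/
def DecisionProblem.DecidableInSubexpTime (P : DecisionProblem) : Prop :=
  ∃ (A : Algorithm) (f : ℕ → ℝ) (p : Polynomial ℕ),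
    (f =o[Filter.atTop] fun m : ℕ => (m : ℝ)) ∧
    P.DecidedInTime A fun x =>
      (2 : ℝ) ^ f (P.size x) * ((p.eval (P.encode x).length : ℕ) : ℝ)

/-! ### Encoding of names -/

/-- Variables and elements of finite sets are named by words over `{0, 1}`. -/
abbrev Name := List Bool

abbrev Triple := Name × Name × Name

/-- A name is written as its bits, followed by a comma. -/
def encodeName (v : Name) : List Symbol :=
  v.map Symbol.bit ++ [Symbol.comma]

/-- A list of names is written one name after the other, followed by a semicolon. -/
def encodeNames (l : List Name) : List Symbol :=
  l.flatMap encodeName ++ [Symbol.semicolon]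

def encodeTriple (t : Triple) : List Symbol :=
  encodeName t.1 ++ encodeName t.2.1 ++ encodeName t.2.2

/-! ### 3-SAT -/

/-- The literal `var` (if `sign = true`) or its negation (if `sign = false`). -/
structure Literal where
  sign : Bool
  var : Name
  deriving DecidableEq

def Literal.Holds (a : Name → Bool) (l : Literal) : Prop :=
  a l.var = l.sign

def encodeLiteral (l : Literal) : List Symbol :=
  Symbol.bit l.sign :: encodeName l.var

/-- A clause with exactly three literals. -/
structure Clause where
  fst : Literal
  snd : Literal
  thd : Literal
  fst_ne_snd : fst ≠ snd
  fst_ne_thd : fst ≠ thd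
  snd_ne_thd : snd ≠ thd

def Clause.Holds (a : Name → Bool) (c : Clause) : Prop :=
  c.fst.Holds a ∨ c.snd.Holds a ∨ c.thd.Holds a

def encodeClause (c : Clause) : List Symbol :=
  encodeLiteral c.fst ++ encodeLiteral c.snd ++ encodeLiteral c.thd

/-- 3-SAT: instances are the conjunctions of finitely many clauses with exactly three literals
each, the size is the number of clauses, and the question is satisfiability. -/
def threeSAT : DecisionProblem where
  Instance := List Clause
  encode φ := φ.flatMap encodeClause
  size φ := φ.length
  IsYes φ := ∃ a : Name → Bool, ∀ c ∈ φ, c.Holds a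

/-- The exponential time hypothesis: no algorithm decides 3-SAT in time `2 ^ o(m)`, where `m` is
the number of clauses. -/
def ExponentialTimeHypothesis : Prop :=
  ¬ threeSAT.DecidableInSubexpTime

/-! ### 3-dimensional matching -/

/-- Finite sets `W`, `X`, `Y` and a set of matches `M ⊆ W × X × Y`, each listed without
repetition. -/
structure ThreeDMInstance where
  W : List Name
  X : List Name
  Y : List Name
  M : List Triple
  W_nodup : W.Nodup
  X_nodup : X.Nodup
  Y_nodup : Y.Nodup
  M_nodup : M.Nodup
  M_subset : ∀ t ∈ M, t.1 ∈ W ∧ t.2.1 ∈ X ∧ t.2.2 ∈ Y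

/-- Some `M' ⊆ M` contains each element of `W`, of `X` and of `Y` exactly once. -/
def ThreeDMInstance.HasPerfectMatching (I : ThreeDMInstance) : Prop :=
  ∃ M' : Finset Triple, M' ⊆ I.M.toFinset ∧
    (∀ w ∈ I.W, ∃! t, t ∈ M' ∧ t.1 = w) ∧
    (∀ x ∈ I.X, ∃! t, t ∈ M' ∧ t.2.1 = x) ∧
    (∀ y ∈ I.Y, ∃! t, t ∈ M' ∧ t.2.2 = y)

/-- 3-dimensional matching, of size `|M|`. -/
def threeDM : DecisionProblem where
  Instance := ThreeDMInstance
  encode I := encodeNames I.W ++ encodeNames I.X ++ encodeNames I.Y ++ I.M.flatMap encodeTriple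
  size I := I.M.length
  IsYes I := I.HasPerfectMatching

/-! ### Exact cover by 3-sets -/

/-- The set of the three entries. -/
def tripleSet (t : Triple) : Finset Name :=
  {t.1, t.2.1, t.2.2}

/-- A finite universe `U` whose number of elements is a multiple of three, and a collection `S` of
subsets of `U` with exactly three elements each; `U` and `S` are listed without repetition, and
every member of `S` is given by listing its three elements. -/
structure X3CInstance where
  U : List Name
  S : List Triple
  U_nodup : U.Nodup
  three_dvd : 3 ∣ U.length
  S_nodup : (S.map tripleSet).Nodup
  S_card : ∀ t ∈ S, (tripleSet t).card = 3
  S_subset : ∀ t ∈ S, tripleSet t ⊆ U.toFinset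

/-- Some `S' ⊆ S` contains each element of `U` in exactly one of its members. -/
def X3CInstance.HasExactCover (I : X3CInstance) : Prop :=
  ∃ S' : Finset (Finset Name), S' ⊆ (I.S.map tripleSet).toFinset ∧
    ∀ u ∈ I.U, ∃! s, s ∈ S' ∧ u ∈ s

/-- Exact cover by 3-sets, of size `|S|`. -/
def exactCoverBy3Sets : DecisionProblem where
  Instance := X3CInstance
  encode I := encodeNames I.U ++ I.S.flatMap encodeTriple
  size I := I.S.length
  IsYes I := I.HasExactCover

end SubexpTime

namespace SubexpTime

/-! A 3-SAT formula with `m` clauses is turned, in polynomial time, into a list of exactly `33 * m`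
triples which is both a 3DM instance and an X3C instance. Since `f (33 * m) = o(m)`, a `2 ^ o(m)`
algorithm for either problem would give one for 3-SAT, contradicting ETH. Everything depends on the
size being linear.

The classical reduction uses a wheel for each variable, whose two exact coverings encode the truth
values, and a pair `s`, `t` for each clause, which must be matched with the tip of a true literal.
Its collection of the remaining tips costs quadratically many triples. Here the construction is made
in three copies, and the three copies of an unused tip form one garbage triple. Any satisfying
assignment is used in the same way in all copies, so the leftover tips agree; conversely copy `0` of
a cover alone yields an assignment. Copy `r` is rotated by `r` coordinates, so the three copies of a
tip lie in three different coordinates and all triples, garbage included, are legitimate matches.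
The wheels are described by a permutation `nx` of the occurrences of literals, whose orbits are the
sets of occurrences of one variable. The combinatorial core is `exists_isCover_iff`;
`hasPerfectMatching_iff` and `hasExactCover_iff` translate it to the two problems.

The hypothesis is about Turing machines, so the reduction must be run on one. Programs of a small
structured language with a timed semantics `Exec` are compiled (`Exec.reachesIn`) and put in front
of a given algorithm (`answersWithin_precompose`). The program `reduction` writes the instance, and
`exec_reduction` proves it correct within an explicit polynomial bound. Clause numbers are written
in unary: names may be long, because only the number of triples enters the exponent. -/

open Turing Function

/-! ### Machine model: compiling stack programs and chaining them with an algorithm. -/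

/-! ### A structured language for multi-stack machines -/

/-- Structured programs over stacks of symbols indexed by `K`. -/
inductive Prog (K : Type) where
  | skip
  /-- Push the symbol `a` on the stack `k`. -/
  | push (k : K) (a : Symbol)
  /-- Pop the stack `k` and push the symbol on all stacks in `ks`; no effect if `k` is empty. -/
  | move (k : K) (ks : List K)
  | seq (p q : Prog K)
  /-- Branch on the topmost symbols of `k` and `k'`. -/
  | ite (k k' : K) (c : Option Symbol → Option Symbol → Bool) (p q : Prog K)
  /-- Repeat `p` as long as the topmost symbols of `k` and `k'` satisfy `c`. -/
  | loop (k k' : K) (c : Option Symbol → Option Symbol → Bool) (p : Prog K)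

abbrev Stacks (K : Type) := K → List Symbol

section Language

variable {K : Type} [DecidableEq K]

def pushAll (a : Symbol) (ks : List K) (s : Stacks K) : Stacks K :=
  ks.foldl (fun s k => update s k (a :: s k)) s

def moveStacks (k : K) (ks : List K) (s : Stacks K) : Stacks K :=
  match s k with
  | [] => s
  | a :: l => pushAll a ks (update s k l)

/-- `Exec p s t s'`: started on the stacks `s`, the program `p` terminates within `t` steps and
leaves the stacks `s'`. -/
inductive Exec : Prog K → Stacks K → ℕ → Stacks K → Prop
  | skip (s) : Exec .skip s 1 s
  | push (k a s) : Exec (.push k a) s 1 (update s k (a :: s k))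
  | move (k ks s) : Exec (.move k ks) s 1 (moveStacks k ks s)
  | seq {p q s t s' t' s''} : Exec p s t s' → Exec q s' t' s'' → Exec (.seq p q) s (t + t') s''
  | ite_true {k k' c p q s t s'} : c (s k).head? (s k').head? = true → Exec p s t s' →
      Exec (.ite k k' c p q) s (t + 1) s'
  | ite_false {k k' c p q s t s'} : c (s k).head? (s k').head? = false → Exec q s t s' →
      Exec (.ite k k' c p q) s (t + 1) s'
  | loop_done {k k' c p s} : c (s k).head? (s k').head? = false → Exec (.loop k k' c p) s 1 s
  | loop_step {k k' c p s t s' t' s''} : c (s k).head? (s k').head? = true → Exec p s t s' →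
      Exec (.loop k k' c p) s' t' s'' → Exec (.loop k k' c p) s (t + 1 + t') s''
  | weaken {p s t t' s'} : Exec p s t s' → t ≤ t' → Exec p s t' s'

end Language

/-! ### Compilation -/

/-- The control positions of a program. -/
def Pos {K : Type} : Prog K → Type
  | .skip => Unit
  | .push _ _ => Unit
  | .move _ _ => Unit
  | .seq p q => Pos p ⊕ Pos q
  | .ite _ _ _ p q => Option (Pos p ⊕ Pos q)
  | .loop _ _ _ p => Option (Pos p)

noncomputable instance Pos.instFintype {K : Type} : (p : Prog K) → Fintype (Pos p)
  | .skip => inferInstanceAs (Fintype Unit)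
  | .push _ _ => inferInstanceAs (Fintype Unit)
  | .move _ _ => inferInstanceAs (Fintype Unit)
  | .seq p q =>
    have := Pos.instFintype p
    have := Pos.instFintype q
    inferInstanceAs (Fintype (Pos p ⊕ Pos q))
  | .ite _ _ _ p q =>
    have := Pos.instFintype p
    have := Pos.instFintype q
    inferInstanceAs (Fintype (Option (Pos p ⊕ Pos q)))
  | .loop _ _ _ p =>
    have := Pos.instFintype p
    inferInstanceAs (Fintype (Option (Pos p)))

def entry {K : Type} : (p : Prog K) → Pos p
  | .skip => ()
  | .push _ _ => ()
  | .move _ _ => ()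
  | .seq p _ => Sum.inl (entry p)
  | .ite _ _ _ _ _ => none
  | .loop _ _ _ _ => none

section Compile

variable {K : Type} [DecidableEq K] (tm : FinTM2) {L : Type}

/-- The stacks of the compiled machine: those of `tm` and those of the program. -/
abbrev JointΓ (K : Type) (tm : FinTM2) : tm.K ⊕ K → Type
  | Sum.inl k => tm.Γ k
  | Sum.inr _ => Symbol

/-- The state of `tm`, together with two registers for topmost symbols. -/
abbrev JointState (tm : FinTM2) := tm.σ × Option Symbol × Option Symbol

abbrev JointStmt (K : Type) (tm : FinTM2) (L : Type) := TM2.Stmt (JointΓ K tm) L (JointState tm)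

abbrev JointCfg (K : Type) (tm : FinTM2) (L : Type) := TM2.Cfg (JointΓ K tm) L (JointState tm)

variable {tm}

/-- Clearing both registers at every jump gives each control position a canonical configuration, and
makes the final configuration literally the one demanded of a halted machine. -/
def resetGoto (l : L) : JointStmt K tm L :=
  .load (fun v => (v.1, none, none)) (.goto fun _ => l)

def pushAllStmt (ks : List K) (q : JointStmt K tm L) : JointStmt K tm L :=
  -- The default `Symbol.comma` is never pushed: `code` reaches this statement only after testing
  -- that the register is nonempty.
  ks.foldr (fun k q => .push (Sum.inr k) (fun v => v.2.1.getD Symbol.comma) q) q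

def testStmt (k k' : K) (c : Option Symbol → Option Symbol → Bool) (l l' : L) :
    JointStmt K tm L :=
  .peek (Sum.inr k) (fun v o => (v.1, o, none)) <|
  .peek (Sum.inr k') (fun v o => (v.1, v.2.1, o)) <|
  .branch (fun v => c v.2.1 v.2.2) (resetGoto l) (resetGoto l')

/-- Code is generated in continuation style: `emb` places the positions of the subprogram among the
labels of the whole machine, and `exit` is the label reached on completion. The body of a loop
therefore exits to the test of that loop. -/
def code : (p : Prog K) → (Pos p → L) → L → Pos p → JointStmt K tm L
  | .skip, _, exit, _ => resetGoto exit
  | .push k a, _, exit, _ => .push (Sum.inr k) (fun _ => a) (resetGoto exit)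
  | .move k ks, _, exit, _ =>
    .pop (Sum.inr k) (fun v o => (v.1, o, none)) <|
    .branch (fun v => v.2.1.isSome) (pushAllStmt ks (resetGoto exit)) (resetGoto exit)
  | .seq p q, emb, exit, pos =>
    match pos with
    | Sum.inl x => code p (emb ∘ Sum.inl) (emb (Sum.inr (entry q))) x
    | Sum.inr x => code q (emb ∘ Sum.inr) exit x
  | .ite k k' c p q, emb, exit, pos =>
    match pos with
    | none => testStmt k k' c (emb (some (Sum.inl (entry p)))) (emb (some (Sum.inr (entry q))))
    | some (Sum.inl x) => code p (emb ∘ some ∘ Sum.inl) exit x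
    | some (Sum.inr x) => code q (emb ∘ some ∘ Sum.inr) exit x
  | .loop k k' c p, emb, exit, pos =>
    match pos with
    | none => testStmt k k' c (emb (some (entry p))) exit
    | some x => code p (emb ∘ some) (emb none) x

/-- The stacks of `tm` and the stacks of the program, side by side. -/
def joint (S : ∀ k, List (tm.Γ k)) (s : Stacks K) : ∀ k, List (JointΓ K tm k)
  | Sum.inl k => S k
  | Sum.inr k => s k

omit [DecidableEq K] in
theorem joint_inr (S : ∀ k, List (tm.Γ k)) (s : Stacks K) (k : K) :
    joint S s (Sum.inr k) = s k := rfl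

theorem update_joint_inr (S : ∀ k, List (tm.Γ k)) (s : Stacks K) (k : K) (l : List Symbol) :
    update (joint S s) (Sum.inr k) l = joint S (update s k l) := by
  funext x
  rcases x with x | x
  · rw [update_of_ne (by simp)]; rfl
  · by_cases h : x = k
    · subst h; simp [joint]
    · rw [update_of_ne (by simpa using h)]; simp [joint, update_of_ne h]

theorem update_joint_inl (S : ∀ k, List (tm.Γ k)) (s : Stacks K) (k : tm.K) (l : List (tm.Γ k)) :
    update (joint S s) (Sum.inl k) l = joint (update S k l) s := by
  funext x
  rcases x with x | x
  · by_cases h : x = k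
    · subst h; simp [joint]
    · rw [update_of_ne (by simpa using h)]; simp [joint, update_of_ne h]
  · rw [update_of_ne (by simp)]; rfl

/-- `c'` is reached from `c` in exactly `n` steps. -/
def ReachesIn {C : Type} (f : C → Option C) (n : ℕ) (c c' : C) : Prop :=
  (flip bind f)^[n] (some c) = some c'

theorem ReachesIn.refl {C : Type} (f : C → Option C) (c : C) : ReachesIn f 0 c c := rfl

theorem ReachesIn.trans {C : Type} {f : C → Option C} {m n : ℕ} {a b c : C}
    (h : ReachesIn f m a b) (h' : ReachesIn f n b c) : ReachesIn f (m + n) a c := by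
  unfold ReachesIn at *
  rw [Nat.add_comm, iterate_add_apply, h, h']

theorem ReachesIn.single {C : Type} {f : C → Option C} {a b : C} (h : f a = some b) :
    ReachesIn f 1 a b := by
  simp [ReachesIn, flip, h]

theorem stepAux_resetGoto (l : L) (v : JointState tm) (S) :
    TM2.stepAux (resetGoto (K := K) l) v S = ⟨some l, (v.1, none, none), S⟩ := rfl

theorem stepAux_pushAllStmt (ks : List K) (l : L) (v : tm.σ) (a : Symbol) (o : Option Symbol)
    (S : ∀ k, List (tm.Γ k)) (s : Stacks K) :
    TM2.stepAux (pushAllStmt ks (resetGoto l)) (v, some a, o) (joint S s) =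
      ⟨some l, (v, none, none), joint S (pushAll a ks s)⟩ := by
  induction ks generalizing s with
  | nil => rfl
  | cons k ks ih =>
    simp only [pushAllStmt, List.foldr_cons, pushAll, List.foldl_cons] at ih ⊢
    rw [TM2.stepAux, ← ih]
    congr 1
    exact update_joint_inr S s k _

theorem stepAux_testStmt (k k' : K) (c : Option Symbol → Option Symbol → Bool) (l l' : L)
    (v : tm.σ) (S : ∀ k, List (tm.Γ k)) (s : Stacks K) :
    TM2.stepAux (testStmt k k' c l l') (v, none, none) (joint S s) =
      ⟨some (if c (s k).head? (s k').head? then l else l'), (v, none, none), joint S s⟩ := by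
  simp only [testStmt, TM2.stepAux, stepAux_resetGoto, joint_inr]
  cases c (s k).head? (s k').head? <;> rfl

theorem stepAux_code_push (k : K) (a : Symbol) (emb : Unit → L) (exit : L) (v : tm.σ)
    (S : ∀ k, List (tm.Γ k)) (s : Stacks K) :
    TM2.stepAux (code (.push k a) emb exit ()) (v, none, none) (joint S s) =
      ⟨some exit, (v, none, none), joint S (update s k (a :: s k))⟩ := by
  rw [← update_joint_inr]; rfl

theorem stepAux_code_move (k : K) (ks : List K) (emb : Unit → L) (exit : L) (v : tm.σ)
    (S : ∀ k, List (tm.Γ k)) (s : Stacks K) :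
    TM2.stepAux (code (.move k ks) emb exit ()) (v, none, none) (joint S s) =
      ⟨some exit, (v, none, none), joint S (moveStacks k ks s)⟩ := by
  simp only [code, TM2.stepAux, moveStacks, joint_inr, stepAux_resetGoto]
  rw [update_joint_inr]
  cases h : s k with
  | nil =>
    have : update s k [] = s := by rw [← h, update_eq_self]
    simp [this]
  | cons a l => simp [stepAux_pushAllStmt]

/-- The compiled program simulates the program. -/
theorem Exec.reachesIn {M : L → JointStmt K tm L} {p : Prog K} {s s' : Stacks K} {t : ℕ}
    (h : Exec p s t s') (emb : Pos p → L) (exit : L) (hM : ∀ x, M (emb x) = code p emb exit x)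
    (v : tm.σ) (S : ∀ k, List (tm.Γ k)) :
    ∃ n ≤ t, ReachesIn (TM2.step M) n ⟨some (emb (entry p)), (v, none, none), joint S s⟩
      ⟨some exit, (v, none, none), joint S s'⟩ := by
  induction h generalizing exit with
  | skip s =>
    refine ⟨1, le_rfl, .single ?_⟩
    rw [TM2.step, hM, code, stepAux_resetGoto]
  | push k a s =>
    refine ⟨1, le_rfl, .single ?_⟩
    rw [TM2.step, hM, ← stepAux_code_push k a emb exit]; rfl
  | move k ks s =>
    refine ⟨1, le_rfl, .single ?_⟩
    rw [TM2.step, hM, ← stepAux_code_move k ks emb exit]; rfl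
  | @seq p q s t s' t' s'' _ _ ih ih' =>
    obtain ⟨n, hn, h⟩ := ih (emb ∘ Sum.inl) (emb (Sum.inr (entry q))) fun x => hM (Sum.inl x)
    obtain ⟨n', hn', h'⟩ := ih' (emb ∘ Sum.inr) exit fun x => hM (Sum.inr x)
    exact ⟨n + n', by omega, h.trans h'⟩
  | @ite_true k k' c p q s t s' hc _ ih =>
    obtain ⟨n, hn, h⟩ := ih (emb ∘ some ∘ Sum.inl) exit fun x => hM (some (Sum.inl x))
    refine ⟨1 + n, by omega, ReachesIn.trans (.single ?_) h⟩
    rw [TM2.step, hM]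
    exact congrArg some ((stepAux_testStmt ..).trans (by rw [hc]; rfl))
  | @ite_false k k' c p q s t s' hc _ ih =>
    obtain ⟨n, hn, h⟩ := ih (emb ∘ some ∘ Sum.inr) exit fun x => hM (some (Sum.inr x))
    refine ⟨1 + n, by omega, ReachesIn.trans (.single ?_) h⟩
    rw [TM2.step, hM]
    exact congrArg some ((stepAux_testStmt ..).trans (by rw [hc]; rfl))
  | @loop_done k k' c p s hc =>
    refine ⟨1, le_rfl, .single ?_⟩
    rw [TM2.step, hM]
    exact congrArg some ((stepAux_testStmt ..).trans (by rw [hc]; rfl))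
  | @loop_step k k' c p s t s' t' s'' hc _ _ ih ih' =>
    obtain ⟨n, hn, h⟩ := ih (emb ∘ some) (emb none) fun x => hM (some x)
    obtain ⟨n', hn', h'⟩ := ih' emb exit hM
    refine ⟨1 + n + n', by omega, (ReachesIn.trans (.single ?_) h).trans h'⟩
    rw [TM2.step, hM]
    exact congrArg some ((stepAux_testStmt ..).trans (by rw [hc]; rfl))
  | weaken _ hle ih =>
    obtain ⟨n, hn, h⟩ := ih emb exit hM
    exact ⟨n, hn.trans hle, h⟩

end Compile

/-! ### Running an algorithm on the output of a program -/

section Precompose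

variable {K : Type} [DecidableEq K] [Fintype K]

/-- A statement of `tm`, as a statement of the joint machine. -/
def liftStmt (K : Type) {tm : FinTM2} (P : Type) :
    TM2.Stmt tm.Γ tm.Λ tm.σ → JointStmt K tm (tm.Λ ⊕ P)
  | .push k f q => .push (Sum.inl k) (fun v => f v.1) (liftStmt K P q)
  | .peek k f q => .peek (Sum.inl k) (fun v o => (f v.1 o, v.2)) (liftStmt K P q)
  | .pop k f q => .pop (Sum.inl k) (fun v o => (f v.1 o, v.2)) (liftStmt K P q)
  | .load f q => .load (fun v => (f v.1, v.2)) (liftStmt K P q)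
  | .branch f q q' => .branch (fun v => f v.1) (liftStmt K P q) (liftStmt K P q')
  | .goto f => .goto fun v => Sum.inl (f v.1)
  | .halt => .halt

/-- A configuration of `tm`, with the stacks of the program empty. -/
def liftCfg (K : Type) {tm : FinTM2} (P : Type) (c : tm.Cfg) : JointCfg K tm (tm.Λ ⊕ P) :=
  ⟨c.l.map Sum.inl, (c.var, none, none), joint c.stk fun _ => []⟩

omit [Fintype K] in
theorem stepAux_liftStmt {tm : FinTM2} (P : Type) (q : TM2.Stmt tm.Γ tm.Λ tm.σ) (v : tm.σ)
    (S : ∀ k, List (tm.Γ k)) :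
    TM2.stepAux (liftStmt K P q) (v, none, none) (joint S fun _ => []) =
      liftCfg K P (TM2.stepAux q v S) := by
  induction q generalizing v S with
  | push k f q ih =>
    rw [liftStmt, TM2.stepAux, TM2.stepAux, ← ih, ← update_joint_inl]; rfl
  | peek k f q ih => rw [liftStmt, TM2.stepAux, TM2.stepAux, ← ih]; rfl
  | pop k f q ih =>
    rw [liftStmt, TM2.stepAux, TM2.stepAux, ← ih, ← update_joint_inl]; rfl
  | load f q ih => rw [liftStmt, TM2.stepAux, TM2.stepAux, ← ih]
  | branch f q q' ih ih' =>
    rw [liftStmt, TM2.stepAux, TM2.stepAux, ih, ih']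
    cases f v <;> rfl
  | goto f => rfl
  | halt => rfl

/-- Move the reversal of the stack `out` to the input stack of `A`, then start `A`. -/
def transferStmt (A : Algorithm) (out : K) (P : Type) :
    JointStmt K A.tm (A.tm.Λ ⊕ Option P) :=
  .pop (Sum.inr out) (fun v o => (v.1, o, none)) <|
  .branch (fun v => v.2.1.isSome)
    (.push (Sum.inl A.tm.k₀) (fun v => A.inputAlphabet.symm (v.2.1.getD Symbol.comma))
      (resetGoto (Sum.inr none)))
    (resetGoto (Sum.inl A.tm.main))

/-- Run the program `p` with input stack `inp`, then run `A` on the reversal of the stack `out`. -/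
noncomputable def precompose (A : Algorithm) (p : Prog K) (inp out : K) : Algorithm where
  tm :=
    { K := A.tm.K ⊕ K
      kDecidableEq := inferInstance
      kFin := have := A.tm.kFin; inferInstance
      k₀ := Sum.inr inp
      k₁ := Sum.inl A.tm.k₁
      Γ := JointΓ K A.tm
      Λ := A.tm.Λ ⊕ Option (Pos p)
      main := Sum.inr (some (entry p))
      ΛFin := have := A.tm.ΛFin; inferInstance
      σ := JointState A.tm
      initialState := (A.tm.initialState, none, none)
      σFin := have := A.tm.σFin; inferInstance
      Γk₀Fin := inferInstanceAs (Fintype Symbol)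
      m := fun
        | Sum.inl l => liftStmt K _ (A.tm.m l)
        | Sum.inr none => transferStmt A out (Pos p)
        | Sum.inr (some x) => code p (Sum.inr ∘ some) (Sum.inr none) x }
  inputAlphabet := Equiv.refl Symbol
  outputAlphabet := A.outputAlphabet

theorem initList_stk (tm : FinTM2) (w : List (tm.Γ tm.k₀)) :
    (initList tm w).stk = update (fun _ => []) tm.k₀ w := by
  funext k
  by_cases h : k = tm.k₀
  · subst h; simp [initList]
  · simp [initList, h]

theorem haltList_stk (tm : FinTM2) (w : List (tm.Γ tm.k₁)) :
    (haltList tm w).stk = update (fun _ => []) tm.k₁ w := by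
  funext k
  by_cases h : k = tm.k₁
  · subst h; simp [haltList]
  · simp [haltList, h]

theorem precompose_initList (A : Algorithm) (p : Prog K) (inp out : K) (w : List Symbol) :
    initList (precompose A p inp out).tm w =
      (⟨some (Sum.inr (some (entry p))), (A.tm.initialState, none, none),
        joint (fun _ => []) (update (fun _ => []) inp w)⟩ : JointCfg K A.tm _) := by
  have h := initList_stk (precompose A p inp out).tm w
  have h' : update (joint (K := K) (tm := A.tm) (fun _ => []) (fun _ => [])) (Sum.inr inp) w
      = joint (fun _ => []) (update (fun _ => []) inp w) := update_joint_inr _ _ _ _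
  rw [← h']
  have h0 : joint (K := K) (tm := A.tm) (fun _ => []) (fun _ => []) = fun _ => [] := by
    funext k; cases k <;> rfl
  rw [h0]
  exact congrArg (fun S => (⟨some (Sum.inr (some (entry p))), (A.tm.initialState, none, none),
    S⟩ : JointCfg K A.tm (A.tm.Λ ⊕ Option (Pos p)))) h

theorem precompose_haltList (A : Algorithm) (p : Prog K) (inp out : K)
    (w : List (A.tm.Γ A.tm.k₁)) :
    haltList (precompose A p inp out).tm w = liftCfg K _ (haltList A.tm w) := by
  have h := haltList_stk (precompose A p inp out).tm w
  have h' : update (joint (K := K) (tm := A.tm) (fun _ => []) (fun _ => [])) (Sum.inl A.tm.k₁) w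
      = joint (update (fun _ => []) A.tm.k₁ w) (fun _ => []) := update_joint_inl _ _ _ _
  have h0 : joint (K := K) (tm := A.tm) (fun _ => []) (fun _ => []) = fun _ => [] := by
    funext k; cases k <;> rfl
  rw [h0] at h'
  unfold liftCfg
  rw [haltList_stk A.tm w, ← h']
  exact congrArg (fun S => (⟨none, (A.tm.initialState, none, none),
    S⟩ : JointCfg K A.tm (A.tm.Λ ⊕ Option (Pos p)))) h

/-- Lifting commutes with a single step, halted configurations included, and hence with all
iterates. -/
theorem precompose_reachesIn_lift (A : Algorithm) (p : Prog K) (inp out : K) {n : ℕ}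
    {c c' : A.tm.Cfg} (h : ReachesIn A.tm.step n c c') :
    ReachesIn (precompose A p inp out).tm.step n (liftCfg K _ c) (liftCfg K _ c') := by
  have hstep : ∀ c : A.tm.Cfg, (precompose A p inp out).tm.step (liftCfg K _ c) =
      (A.tm.step c).map (liftCfg K (Option (Pos p))) := by
    rintro ⟨_ | l, v, S⟩
    · rfl
    · exact congrArg some (stepAux_liftStmt _ _ _ _)
  have hiter : ∀ o : Option A.tm.Cfg,
      (flip bind (precompose A p inp out).tm.step)^[n] (o.map (liftCfg K (Option (Pos p)))) =
        ((flip bind A.tm.step)^[n] o).map (liftCfg K (Option (Pos p))) := by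
    clear h
    induction n with
    | zero => intro o; rfl
    | succ n ih =>
      intro o
      rw [iterate_succ_apply, iterate_succ_apply, ← ih]
      congr 1
      cases o with
      | none => rfl
      | some c => exact hstep c
  have := hiter (some c)
  rw [h] at this
  exact this

omit [Fintype K] in
theorem stepAux_transferStmt_nil (A : Algorithm) (out : K) (P : Type) (v : A.tm.σ)
    (S : ∀ k, List (A.tm.Γ k)) (s : Stacks K) (h : s out = []) :
    TM2.stepAux (transferStmt A out P) (v, none, none) (joint S s) =
      ⟨some (Sum.inl A.tm.main), (v, none, none), joint S s⟩ := by
  simp only [transferStmt, TM2.stepAux, joint_inr, stepAux_resetGoto]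
  rw [update_joint_inr]
  have : update s out [] = s := by rw [← h, update_eq_self]
  simp [h, this]

omit [Fintype K] in
theorem stepAux_transferStmt_cons (A : Algorithm) (out : K) (P : Type) (v : A.tm.σ)
    (S : ∀ k, List (A.tm.Γ k)) (s : Stacks K) (a : Symbol) (l : List Symbol)
    (h : s out = a :: l) :
    TM2.stepAux (transferStmt A out P) (v, none, none) (joint S s) =
      ⟨some (Sum.inr none), (v, none, none),
        joint (update S A.tm.k₀ (A.inputAlphabet.symm a :: S A.tm.k₀)) (update s out l)⟩ := by
  simp only [transferStmt, TM2.stepAux, joint_inr, stepAux_resetGoto]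
  rw [update_joint_inr, ← update_joint_inl]
  simp [h]
  rfl

/-- One step per symbol, and one more to notice that the stack is empty. Popping reverses the word,
so a program may write its output by pushing from left to right. -/
theorem precompose_transfer (A : Algorithm) (p : Prog K) (inp out : K) (l : List Symbol)
    (l' : List (A.tm.Γ A.tm.k₀)) :
    ReachesIn (precompose A p inp out).tm.step (l.length + 1)
      (⟨some (Sum.inr none), (A.tm.initialState, none, none),
        joint (update (fun _ => []) A.tm.k₀ l') (update (fun _ => []) out l)⟩ :
          JointCfg K A.tm (A.tm.Λ ⊕ Option (Pos p)))
      (liftCfg K _ (initList A.tm (l.reverse.map A.inputAlphabet.symm ++ l'))) := by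
  induction l generalizing l' with
  | nil =>
    refine .single (congrArg some ((stepAux_transferStmt_nil A out _ _ _ _ ?_).trans ?_))
    · exact update_self ..
    · unfold liftCfg
      rw [initList_stk]
      have : update (fun _ : K => ([] : List Symbol)) out [] = fun _ => [] :=
        update_eq_self out _
      rw [this]
      rfl
  | cons a l ih =>
    rw [List.length_cons, Nat.add_comm (l.length + 1)]
    have := ih (A.inputAlphabet.symm a :: l')
    rw [List.reverse_cons, List.map_append, List.append_assoc]
    refine ReachesIn.trans
      (.single (congrArg some ((stepAux_transferStmt_cons A out _ _ _ _ a l ?_).trans ?_))) this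
    · exact update_self ..
    · rw [update_idem, update_idem, update_self]

/-- Three runs are concatenated: the program, the transfer, and the lifted run of `A`. The program
must leave every stack but `out` empty, as the lifted run starts from, and halts in, configurations
whose program stacks are empty. -/
theorem answersWithin_precompose {A : Algorithm} {p : Prog K} {inp out : K} {w w' : List Symbol}
    {t t' : ℕ} {b : Bool}
    (hp : Exec p (update (fun _ => []) inp w) t (update (fun _ => []) out w'.reverse))
    (hA : A.AnswersWithin w' b t') :
    (precompose A p inp out).AnswersWithin w b (t + (w'.length + 1) + t') := by
  obtain ⟨⟨⟨n₃, h₃⟩, hn₃⟩⟩ := hA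
  obtain ⟨n₁, hn₁, h₁⟩ := hp.reachesIn (M := (precompose A p inp out).tm.m) (Sum.inr ∘ some)
    (Sum.inr none) (fun _ => rfl) A.tm.initialState (fun _ => [])
  have h₂ := precompose_transfer A p inp out w'.reverse []
  rw [List.reverse_reverse, List.append_nil, List.length_reverse] at h₂
  have h₃' := precompose_reachesIn_lift A p inp out h₃
  rw [← precompose_haltList] at h₃'
  have h0 : update (fun _ => []) A.tm.k₀ [] = fun k : A.tm.K => ([] : List (A.tm.Γ k)) :=
    update_eq_self A.tm.k₀ _
  rw [h0] at h₂
  have h := (ReachesIn.trans h₁ h₂).trans h₃'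
  have hw : w.map (precompose A p inp out).inputAlphabet.symm = w := List.map_id w
  refine ⟨⟨⟨n₁ + (w'.length + 1) + n₃, ?_⟩, ?_⟩⟩
  · rw [hw, precompose_initList]
    exact h
  · have : n₃ ≤ t' := hn₃
    show n₁ + (w'.length + 1) + n₃ ≤ _
    omega

end Precompose

/-! ### Combinatorics: from formulas to exact covers and matchings. -/

/-! ### Exact covers from truth assignments -/

/-- The elements of the reduction which belong to one clause, up to copies: `a q`, `b q` form the
wheel of the variable of the `q`-th literal, `tip β q` is the tip of that literal for the truth
value `β`, and `s`, `t` belong to the clause. -/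
inductive Part where
  | a (q : Fin 3)
  | b (q : Fin 3)
  | tip (β : Bool) (q : Fin 3)
  | s
  | t
  deriving DecidableEq

/-- A part, in one of three copies. -/
abbrev Tag := Fin 3 × Part

abbrev Elem (m : ℕ) := Fin m × Tag

/-- Occurrences of literals: the number of the clause and the position in the clause. -/
abbrev Occ (m : ℕ) := Fin m × Fin 3

/-- The triples attached to an occurrence of a literal. -/
inductive Gadget where
  | wheel (r : Fin 3) (β : Bool)
  | clause (r : Fin 3)
  | garbage (β : Bool)
  deriving DecidableEq

abbrev Label (m : ℕ) := Occ m × Gadget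

def rotate {α : Type} : Fin 3 → α × α × α → α × α × α
  | 0, (x, y, z) => (x, y, z)
  | 1, (x, y, z) => (z, x, y)
  | 2, (x, y, z) => (y, z, x)

/-- Membership in a triple. -/
def InTriple {α : Type} (e : α) (t : α × α × α) : Prop := e = t.1 ∨ e = t.2.1 ∨ e = t.2.2

theorem inTriple_rotate {α : Type} (e : α) (r : Fin 3) (x y z : α) :
    InTriple e (rotate r (x, y, z)) ↔ e = x ∨ e = y ∨ e = z := by
  unfold InTriple
  fin_cases r <;> simp only [rotate] <;> tauto

section Cover

variable {m : ℕ} (nx : Occ m → Occ m) (sgn : Occ m → Bool)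

/-- The wheel triple for `β` uses up the tip for `!β` and leaves the tip for `β` free. Its `a`
element belongs to `o` if `β` is true and to `nx o` otherwise, which couples neighbours on the
wheel. Garbage lists the copies as `1, 2, 0` because the tip of copy `r` sits in coordinate `2 + r`
modulo `3`. -/
def gadgetTriple (o : Occ m) : Gadget → Elem m × Elem m × Elem m
  | .wheel r β =>
    let o' := if β then o else nx o
    rotate r ((o'.1, r, .a o'.2), (o.1, r, .b o.2), (o.1, r, .tip (!β) o.2))
  | .clause r => rotate r ((o.1, r, .s), (o.1, r, .t), (o.1, r, .tip (sgn o) o.2))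
  | .garbage β => ((o.1, 1, .tip β o.2), (o.1, 2, .tip β o.2), (o.1, 0, .tip β o.2))

def labelTriple (l : Label m) : Elem m × Elem m × Elem m := gadgetTriple nx sgn l.1 l.2

theorem inTriple_wheel {e : Elem m} {o : Occ m} {r : Fin 3} {β : Bool} :
    InTriple e (labelTriple nx sgn (o, .wheel r β)) ↔
      e = ((if β then o else nx o).1, r, .a (if β then o else nx o).2) ∨
      e = (o.1, r, .b o.2) ∨ e = (o.1, r, .tip (!β) o.2) :=
  inTriple_rotate ..

theorem inTriple_clause {e : Elem m} {o : Occ m} {r : Fin 3} :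
    InTriple e (labelTriple nx sgn (o, .clause r)) ↔
      e = (o.1, r, .s) ∨ e = (o.1, r, .t) ∨ e = (o.1, r, .tip (sgn o) o.2) :=
  inTriple_rotate ..

theorem inTriple_garbage {e : Elem m} {o : Occ m} {β : Bool} :
    InTriple e (labelTriple nx sgn (o, .garbage β)) ↔ ∃ r, e = (o.1, r, .tip β o.2) := by
  unfold InTriple labelTriple gadgetTriple
  constructor
  · rintro (h | h | h) <;> exact ⟨_, h⟩
  · rintro ⟨r, h⟩
    fin_cases r <;> simp_all

/-- A set of labels whose triples form an exact cover of all elements. -/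
def IsCover (Z : Set (Label m)) : Prop :=
  ∀ e : Elem m, ∃! l, l ∈ Z ∧ InTriple e (labelTriple nx sgn l)

variable {nx sgn}

/-- Two elements identify a triple: `b` and the tip for a wheel, `s` and the tip for a clause, two
copies of a tip for garbage. The `a` elements would not separate truth values, since `nx` may have
fixed points. The lemma makes the listed matches and the listed 3-sets free of repetition. -/
theorem labelTriple_inj {l l' : Label m}
    (h : ∀ e, InTriple e (labelTriple nx sgn l) → InTriple e (labelTriple nx sgn l')) :
    l = l' := by
  obtain ⟨⟨i, q⟩, g⟩ := l
  obtain ⟨⟨i', q'⟩, g'⟩ := l'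
  cases g with
  | wheel r β =>
    have h1 := h (i, r, .b q) (by simp [inTriple_wheel])
    have h2 := h (i, r, .tip (!β) q) (by simp [inTriple_wheel])
    cases g' <;> simp [inTriple_wheel, inTriple_clause, inTriple_garbage] at h1 h2 ⊢
    grind
  | clause r =>
    have h1 := h (i, r, .s) (by simp [inTriple_clause])
    have h2 := h (i, r, .tip (sgn (i, q)) q) (by simp [inTriple_clause])
    cases g' <;> simp [inTriple_wheel, inTriple_clause, inTriple_garbage] at h1 h2 ⊢
    grind
  | garbage β =>
    have h1 := h (i, 0, .tip β q) (by simp [inTriple_garbage])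
    have h2 := h (i, 1, .tip β q) (by simp [inTriple_garbage])
    cases g' <;> simp [inTriple_wheel, inTriple_clause, inTriple_garbage] at h1 h2 ⊢ <;> grind

/-- The cover belonging to the truth values `val` of the occurrences and to a choice of a true
literal in each clause. -/
def coverOf (val : Occ m → Bool) (ch : Fin m → Fin 3) : Set (Label m) := fun l =>
  match l.2 with
  | .wheel _ β => val l.1 = β
  | .clause _ => ch l.1.1 = l.1.2
  | .garbage β => val l.1 = β ∧ ch l.1.1 ≠ l.1.2

theorem mem_coverOf_wheel {val : Occ m → Bool} {ch : Fin m → Fin 3} {o : Occ m} {r : Fin 3}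
    {β : Bool} : (o, Gadget.wheel r β) ∈ coverOf val ch ↔ val o = β := Iff.rfl

theorem mem_coverOf_clause {val : Occ m → Bool} {ch : Fin m → Fin 3} {o : Occ m} {r : Fin 3} :
    (o, Gadget.clause r) ∈ coverOf val ch ↔ ch o.1 = o.2 := Iff.rfl

theorem mem_coverOf_garbage {val : Occ m → Bool} {ch : Fin m → Fin 3} {o : Occ m} {β : Bool} :
    (o, Gadget.garbage β) ∈ coverOf val ch ↔ val o = β ∧ ch o.1 ≠ o.2 := Iff.rfl

/-- Constancy of `val` along `nx` makes the chosen wheel triples cover every `a` once: by its own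
occurrence for the value true, by its predecessor for false. A tip that the wheel leaves free goes
to the clause triple if its literal is the chosen one, and to garbage otherwise; `hch` says that the
tip needed by the clause is free. -/
theorem isCover_coverOf {val : Occ m → Bool} {ch : Fin m → Fin 3} (hnx : Bijective nx)
    (hval : ∀ o, val (nx o) = val o) (hch : ∀ i, val (i, ch i) = sgn (i, ch i)) :
    IsCover nx sgn (coverOf val ch) := by
  rintro ⟨i, r, p⟩
  cases p with
  | a q =>
    obtain ⟨o, ho⟩ := hnx.2 (i, q)
    cases hv : val (i, q) with
    | true =>
      refine ⟨((i, q), .wheel r true), by simp [mem_coverOf_wheel, inTriple_wheel, hv], ?_⟩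
      rintro ⟨⟨i', q'⟩, g⟩ ⟨h1, h2⟩
      rcases g with ⟨r', _ | _⟩ | r' | β <;>
        simp [inTriple_wheel, inTriple_clause, inTriple_garbage, mem_coverOf_wheel] at h1 h2 ⊢
      · have h3 : nx (i', q') = (i, q) := Prod.ext h2.1.symm h2.2.2.symm
        have := hval (i', q')
        grind
      · grind
    | false =>
      have hv' : val o = false := by rw [← hval, ho, hv]
      refine ⟨(o, .wheel r false),
        by simp [mem_coverOf_wheel, inTriple_wheel, hv', ho], ?_⟩
      rintro ⟨⟨i', q'⟩, g⟩ ⟨h1, h2⟩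
      rcases g with ⟨r', _ | _⟩ | r' | β <;>
        simp [inTriple_wheel, inTriple_clause, inTriple_garbage, mem_coverOf_wheel] at h1 h2 ⊢
      · have h3 : nx (i', q') = (i, q) := Prod.ext h2.1.symm h2.2.2.symm
        exact ⟨hnx.1 (h3.trans ho.symm), h2.2.1.symm⟩
      · grind
  | b q =>
    refine ⟨((i, q), .wheel r (val (i, q))), by simp [mem_coverOf_wheel, inTriple_wheel], ?_⟩
    rintro ⟨⟨i', q'⟩, g⟩ ⟨h1, h2⟩
    rcases g with ⟨r', β⟩ | r' | β <;>
      simp [inTriple_wheel, inTriple_clause, inTriple_garbage, mem_coverOf_wheel] at h1 h2 ⊢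
    grind
  | s =>
    refine ⟨((i, ch i), .clause r), by simp [mem_coverOf_clause, inTriple_clause], ?_⟩
    rintro ⟨⟨i', q'⟩, g⟩ ⟨h1, h2⟩
    rcases g with ⟨r', β⟩ | r' | β <;>
      simp [inTriple_wheel, inTriple_clause, inTriple_garbage, mem_coverOf_clause] at h1 h2 ⊢
    grind
  | t =>
    refine ⟨((i, ch i), .clause r), by simp [mem_coverOf_clause, inTriple_clause], ?_⟩
    rintro ⟨⟨i', q'⟩, g⟩ ⟨h1, h2⟩
    rcases g with ⟨r', β⟩ | r' | β <;>
      simp [inTriple_wheel, inTriple_clause, inTriple_garbage, mem_coverOf_clause] at h1 h2 ⊢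
    grind
  | tip β q =>
    have key : ∃ g : Gadget, ((i, q), g) ∈ coverOf val ch ∧
        InTriple (i, r, .tip β q) (labelTriple nx sgn ((i, q), g)) := by
      by_cases hv : val (i, q) = β
      · by_cases hc : ch i = q
        · refine ⟨.clause r, hc, ?_⟩
          have := hch i
          subst hc
          simp [inTriple_clause, ← this, hv]
        · exact ⟨.garbage β, ⟨hv, hc⟩, by simp [inTriple_garbage]⟩
      · refine ⟨.wheel r (!β), ?_, by simp [inTriple_wheel]⟩
        rw [mem_coverOf_wheel]
        exact Bool.eq_not.2 hv
    obtain ⟨g, hg, hg'⟩ := key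
    refine ⟨((i, q), g), ⟨hg, hg'⟩, ?_⟩
    rintro ⟨⟨i', q'⟩, g'⟩ ⟨h1, h2⟩
    -- Every triple containing a tip belongs to the occurrence of that tip, so only the gadgets at
    -- one occurrence compete.
    have hi : i' = i ∧ q' = q := by
      rcases g' with ⟨r', β⟩ | r' | β <;>
        simp [inTriple_wheel, inTriple_clause, inTriple_garbage] at h2 <;> grind
    obtain ⟨rfl, rfl⟩ := hi
    have hci := hch i'
    rcases g with ⟨r₁, β₁⟩ | r₁ | β₁ <;> rcases g' with ⟨r₂, β₂⟩ | r₂ | β₂ <;>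
      simp only [inTriple_wheel, inTriple_clause, inTriple_garbage, mem_coverOf_wheel,
        mem_coverOf_clause, mem_coverOf_garbage, Prod.mk.injEq, Part.tip.injEq, true_and,
        reduceCtorEq, and_false, false_or, and_true, exists_eq_left']
        at h1 h2 hg hg' ⊢ <;>
      grind

/-- An exact cover treats all occurrences on an orbit of `nx` in the same way. -/
theorem IsCover.wheel_nx {Z : Set (Label m)} (hZ : IsCover nx sgn Z)
    {o : Occ m} (h : (nx o, Gadget.wheel 0 true) ∈ Z) : (o, Gadget.wheel 0 true) ∈ Z := by
  -- The element `b` of `o` lies only in wheel triples of `o`. The one for false would share the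
  -- element `a` of `nx o` with the triple given by `h`.
  obtain ⟨l, ⟨hl, hb⟩, -⟩ := hZ (o.1, 0, .b o.2)
  obtain ⟨⟨i, q⟩, g⟩ := l
  rcases g with ⟨r, β⟩ | r | β <;>
    simp [inTriple_wheel, inTriple_clause, inTriple_garbage] at hb
  obtain ⟨rfl, rfl, rfl⟩ := hb
  cases β with
  | true => exact hl
  | false =>
    have := (hZ ((nx o).1, 0, .a (nx o).2)).unique ⟨h, by simp [inTriple_wheel]⟩
      ⟨hl, by simp [inTriple_wheel]⟩
    simp at this

theorem IsCover.wheel_iterate {Z : Set (Label m)} (hZ : IsCover nx sgn Z)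
    (k : ℕ) {o : Occ m} (h : (nx^[k] o, Gadget.wheel 0 true) ∈ Z) :
    (o, Gadget.wheel 0 true) ∈ Z := by
  induction k generalizing o with
  | zero => exact h
  | succ k ih => exact hZ.wheel_nx (ih h)

/-- Each clause contains a literal whose wheel leaves the tip of the literal uncovered. -/
theorem IsCover.exists_wheel {Z : Set (Label m)} (hZ : IsCover nx sgn Z) (i : Fin m) :
    ∃ q, (sgn (i, q) = true ↔ ((i, q), Gadget.wheel 0 true) ∈ Z) := by
  obtain ⟨⟨⟨i', q⟩, g⟩, ⟨hl, hs⟩, -⟩ := hZ (i, 0, .s)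
  rcases g with ⟨r, β⟩ | r | β <;>
    simp [inTriple_wheel, inTriple_clause, inTriple_garbage] at hs
  obtain ⟨rfl, rfl⟩ := hs
  -- The clause triple covering `s` already uses this tip, so the wheel must not.
  have hn : ((i, q), Gadget.wheel 0 (!sgn (i, q))) ∉ Z := fun h => by
    have := (hZ (i, 0, .tip (sgn (i, q)) q)).unique ⟨h, by simp [inTriple_wheel]⟩
      ⟨hl, by simp [inTriple_clause]⟩
    simp at this
  refine ⟨q, fun h => ?_, fun h => ?_⟩
  · obtain ⟨⟨⟨i', q'⟩, g⟩, ⟨hl', hb⟩, -⟩ := hZ (i, 0, .b q)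
    rcases g with ⟨r, β⟩ | r | β <;>
      simp [inTriple_wheel, inTriple_clause, inTriple_garbage] at hb
    obtain ⟨rfl, rfl, rfl⟩ := hb
    cases β with
    | true => exact hl'
    | false => rw [h] at hn; exact absurd hl' hn
  · by_contra hc
    rw [Bool.not_eq_true] at hc
    rw [hc] at hn
    exact hn h

/-- Exact covers correspond to satisfying assignments. -/
theorem exists_isCover_iff {ν : Type} {var : Occ m → ν} (hnx : Bijective nx)
    (hvar : ∀ o, var (nx o) = var o) (hcyc : ∀ o o', var o = var o' → ∃ k, nx^[k] o = o') :
    (∃ Z, IsCover nx sgn Z) ↔ ∃ α : ν → Bool, ∀ i, ∃ q, α (var (i, q)) = sgn (i, q) := by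
  classical
  constructor
  · rintro ⟨Z, hZ⟩
    -- A variable is true if some occurrence of it uses the true wheel triple in copy `0`; by
    -- `wheel_iterate` and `hcyc` then all its occurrences do.
    refine ⟨fun v => decide (∃ o, var o = v ∧ (o, Gadget.wheel 0 true) ∈ Z), fun i => ?_⟩
    obtain ⟨q, hq⟩ := hZ.exists_wheel i
    refine ⟨q, ?_⟩
    rw [Bool.eq_iff_iff, hq, decide_eq_true_iff]
    constructor
    · rintro ⟨o, ho, h⟩
      obtain ⟨k, rfl⟩ := hcyc _ _ ho.symm
      exact hZ.wheel_iterate k h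
    · exact fun h => ⟨_, rfl, h⟩
  · rintro ⟨α, hα⟩
    choose ch hch using hα
    exact ⟨coverOf (α ∘ var) ch, isCover_coverOf hnx (fun o => by simp [hvar]) hch⟩

end Cover

/-! ### The cyclic successor of an occurrence -/

section Next

variable {ι ν : Type} [DecidableEq ι] [DecidableEq ν]

/-- The cyclically next entry of the list with the same variable. -/
def cycNext (occs : List ι) (var : ι → ν) (o : ι) : ι :=
  (occs.filter fun x => var x = var o).formPerm o

variable {occs : List ι} {var : ι → ν}

theorem var_cycNext (hmem : ∀ o, o ∈ occs) (o : ι) : var (cycNext occs var o) = var o := by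
  have h : cycNext occs var o ∈ occs.filter fun x => var x = var o :=
    List.formPerm_apply_mem_of_mem (by simp [hmem])
  simpa using (List.mem_filter.1 h).2

/-- Equal images have equal variables, so both points are moved by the same permutation. -/
theorem cycNext_injective (hmem : ∀ o, o ∈ occs) : Injective (cycNext occs var) := by
  intro o o' h
  have hv : var o = var o' :=
    (var_cycNext hmem o).symm.trans ((congrArg var h).trans (var_cycNext hmem o'))
  unfold cycNext at h
  rw [hv] at h
  exact Equiv.injective _ h

theorem exists_iterate_cycNext (hmem : ∀ o, o ∈ occs) (hnd : occs.Nodup) {o o' : ι}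
    (h : var o = var o') : ∃ k, (cycNext occs var)^[k] o = o' := by
  obtain ⟨F, hF⟩ : ∃ F, F = occs.filter fun x => decide (var x = var o) := ⟨_, rfl⟩
  have hit : ∀ k, (cycNext occs var)^[k] o = (F.formPerm ^ k) o ∧
      var ((cycNext occs var)^[k] o) = var o := by
    intro k
    induction k with
    | zero => exact ⟨rfl, rfl⟩
    | succ k ih =>
      rw [iterate_succ_apply', var_cycNext (var := var) hmem, pow_succ', Equiv.Perm.mul_apply, ← ih.1]
      refine ⟨?_, ih.2⟩
      rw [cycNext, ih.2, hF]
  have hoF : o ∈ F := by simp [hF, hmem]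
  have hoF' : o' ∈ F := by simp [hF, hmem, h]
  obtain ⟨i, hi, rfl⟩ := List.getElem_of_mem hoF
  obtain ⟨j, hj, rfl⟩ := List.getElem_of_mem hoF'
  -- One full turn is added so that the subtraction does not truncate.
  refine ⟨j + F.length - i, ?_⟩
  rw [(hit _).1, List.formPerm_pow_apply_getElem _ (hF ▸ hnd.filter _)]
  congr 1
  rw [show i + (j + F.length - i) = j + F.length by omega, Nat.add_mod_right, Nat.mod_eq_of_lt hj]

/-- The cyclic successor is found by searching the rest of the list and then the whole list. -/
theorem find?_cycNext (hnd : occs.Nodup) {pre post : List ι} {o : ι}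
    (h : occs = pre ++ o :: post) :
    (post ++ occs).find? (fun x => decide (var x = var o)) = some (cycNext occs var o) := by
  have hF := hnd.filter fun x => decide (var x = var o)
  rw [cycNext, ← List.head?_filter, List.filter_append]
  have hF' : occs.filter (fun x => decide (var x = var o)) =
      pre.filter (fun x => decide (var x = var o)) ++
        o :: post.filter fun x => decide (var x = var o) := by
    rw [h]; simp
  rw [hF'] at hF ⊢
  generalize pre.filter (fun x => decide (var x = var o)) = A at *
  generalize post.filter (fun x => decide (var x = var o)) = B at *
  have hlen : A.length < (A ++ o :: B).length := by simp
  have ho : o = (A ++ o :: B)[A.length] := by simp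
  have hp := List.formPerm_apply_getElem _ hF A.length hlen
  rw [← ho] at hp
  rw [hp]
  -- If nothing with this variable follows `o`, the search wraps around to the first such occurrence
  -- of the whole list, which may be `o` itself.
  cases B with
  | nil => cases A <;> simp
  | cons x B => simp [Nat.mod_eq_of_lt]

end Next

/-! ### Names of the elements -/

def bits (q : Fin 3) : List Bool := [decide (q = 1), decide (q = 2)]

def Part.kind : Part → List Bool
  | .a _ => [false, false, false]
  | .b _ => [false, false, true]
  | .tip β _ => [false, true, β]
  | .s => [true, false, false]
  | .t => [true, false, true]

def Part.position : Part → Fin 3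
  | .a q => q
  | .b q => q
  | .tip _ q => q
  | .s => 0
  | .t => 0

/-- All tags have seven bits, so a name splits uniquely into tag and clause number. The position
comes last: then position and clause number form a suffix of the name, which is what has to be
looked up for the element `a` of the next occurrence. -/
def tagName (τ : Tag) : Name := bits τ.1 ++ τ.2.kind ++ bits τ.2.position

theorem length_tagName (τ : Tag) : (tagName τ).length = 7 := by
  obtain ⟨r, p⟩ := τ
  cases p <;> rfl

theorem bits_injective : Injective bits := by decide

theorem tagName_injective : Injective tagName := by
  rintro ⟨r, p⟩ ⟨r', p'⟩ h
  simp only [tagName, List.append_assoc] at h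
  have h1 := List.append_inj h rfl
  have hr : r = r' := bits_injective h1.1
  have h2 := List.append_inj h1.2 (by cases p <;> cases p' <;> rfl)
  have hq : p.position = p'.position := bits_injective h2.2
  have hk := h2.1
  cases p <;> cases p' <;> simp_all [Part.kind, Part.position]

/-- The name of an element: its tag and the number of the clause in unary. -/
def elemName {m : ℕ} (e : Elem m) : Name := tagName e.2 ++ List.replicate e.1.val true

theorem elemName_injective {m : ℕ} : Injective (elemName (m := m)) := by
  rintro ⟨i, τ⟩ ⟨i', τ'⟩ h
  have h1 := List.append_inj h (by rw [length_tagName, length_tagName])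
  have h2 := congrArg List.length h1.2
  simp only [List.length_replicate] at h2
  exact Prod.ext (Fin.ext h2) (tagName_injective h1.1)

/-! ### The coordinates of the elements -/

/-- The coordinate in which an element occurs in triples. -/
def coord (τ : Tag) : Fin 3 :=
  match τ.2 with
  | .a _ => τ.1
  | .b _ => 1 + τ.1
  | .tip _ _ => 2 + τ.1
  | .s => τ.1
  | .t => 1 + τ.1

def allParts : List Part :=
  [.a 0, .a 1, .a 2, .b 0, .b 1, .b 2, .tip false 0, .tip false 1, .tip false 2,
    .tip true 0, .tip true 1, .tip true 2, .s, .t]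

def tagsAt (k : Fin 3) : List Tag :=
  (List.finRange 3 ×ˢ allParts).filter fun τ => coord τ = k

theorem mem_allParts (p : Part) : p ∈ allParts := by
  rcases p with q | q | ⟨_ | _, q⟩ | _ | _ <;> first | (fin_cases q <;> decide) | decide

theorem mem_tagsAt {k : Fin 3} {τ : Tag} : τ ∈ tagsAt k ↔ coord τ = k := by
  obtain ⟨r, p⟩ := τ
  simp [tagsAt, List.mem_product, mem_allParts, List.mem_finRange]

theorem nodup_tagsAt (k : Fin 3) : (tagsAt k).Nodup :=
  List.Nodup.filter _ (List.Nodup.product (List.nodup_finRange 3) (by decide))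

theorem length_tagsAt (k : Fin 3) : (tagsAt k).length = 14 := by
  revert k; decide

/-- The elements at a coordinate. -/
def elemsAt (m : ℕ) (k : Fin 3) : List (Elem m) := (List.finRange m).reverse ×ˢ tagsAt k

theorem mem_elemsAt {m : ℕ} {k : Fin 3} {e : Elem m} : e ∈ elemsAt m k ↔ coord e.2 = k := by
  obtain ⟨i, τ⟩ := e
  simp [elemsAt, List.mem_product, mem_tagsAt, List.mem_finRange]

theorem nodup_elemsAt (m : ℕ) (k : Fin 3) : (elemsAt m k).Nodup :=
  List.Nodup.product (List.nodup_reverse.2 (List.nodup_finRange m)) (nodup_tagsAt k)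

theorem length_elemsAt (m : ℕ) (k : Fin 3) : (elemsAt m k).length = m * 14 := by
  simp [elemsAt, List.length_product, length_tagsAt]

def gadgets : List Gadget :=
  [.wheel 0 false, .wheel 1 false, .wheel 2 false, .wheel 0 true, .wheel 1 true, .wheel 2 true,
    .clause 0, .clause 1, .clause 2, .garbage false, .garbage true]

theorem mem_gadgets (g : Gadget) : g ∈ gadgets := by
  rcases g with ⟨r, _ | _⟩ | r | _ | _ <;> first | (fin_cases r <;> decide) | decide

def occs (m : ℕ) : List (Occ m) := List.finRange m ×ˢ List.finRange 3

theorem mem_occs {m : ℕ} (o : Occ m) : o ∈ occs m := by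
  obtain ⟨i, q⟩ := o
  simp [occs, List.mem_product, List.mem_finRange]

theorem nodup_occs (m : ℕ) : (occs m).Nodup :=
  List.Nodup.product (List.nodup_finRange m) (List.nodup_finRange 3)

theorem length_occs (m : ℕ) : (occs m).length = m * 3 := by
  simp [occs, List.length_product]

def labels (m : ℕ) : List (Label m) := occs m ×ˢ gadgets

theorem mem_labels {m : ℕ} (l : Label m) : l ∈ labels m := by
  obtain ⟨o, g⟩ := l
  simp [labels, List.mem_product, mem_gadgets, mem_occs]

theorem nodup_labels (m : ℕ) : (labels m).Nodup :=
  List.Nodup.product (nodup_occs m) (by decide)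

theorem length_labels (m : ℕ) : (labels m).length = 33 * m := by
  simp [labels, List.length_product, length_occs, gadgets]
  omega

/-! ### The instances -/

def nameTriple {m : ℕ} (t : Elem m × Elem m × Elem m) : Triple :=
  (elemName t.1, elemName t.2.1, elemName t.2.2)

theorem mem_tripleSet_nameTriple {m : ℕ} {e : Elem m} {t : Elem m × Elem m × Elem m} :
    elemName e ∈ tripleSet (nameTriple t) ↔ InTriple e t := by
  simp [tripleSet, nameTriple, InTriple, elemName_injective.eq_iff]

section Instances

variable {m : ℕ} (nx : Occ m → Occ m) (sgn : Occ m → Bool)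

theorem coord_labelTriple (l : Label m) :
    coord (labelTriple nx sgn l).1.2 = 0 ∧ coord (labelTriple nx sgn l).2.1.2 = 1 ∧
      coord (labelTriple nx sgn l).2.2.2 = 2 := by
  obtain ⟨o, g⟩ := l
  have hr : ∀ r : Fin 3, r = 0 ∨ r = 1 ∨ r = 2 := by decide
  rcases g with ⟨r, β⟩ | r | β
  · rcases hr r with rfl | rfl | rfl <;> simp [labelTriple, gadgetTriple, rotate, coord]
  · rcases hr r with rfl | rfl | rfl <;> simp [labelTriple, gadgetTriple, rotate, coord]
  · simp [labelTriple, gadgetTriple, coord]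

theorem tripleSet_injective :
    Injective fun l : Label m => tripleSet (nameTriple (labelTriple nx sgn l)) := by
  intro l l' h
  refine labelTriple_inj (nx := nx) (sgn := sgn) fun e he => ?_
  rw [← mem_tripleSet_nameTriple] at he ⊢
  exact (congrArg (elemName e ∈ ·) h).mp he

def tripleList : List Triple := (labels m).map fun l => nameTriple (labelTriple nx sgn l)

/-- The instance of 3-dimensional matching. -/
def matchingInstance : ThreeDMInstance where
  W := (elemsAt m 0).map elemName
  X := (elemsAt m 1).map elemName
  Y := (elemsAt m 2).map elemName
  M := tripleList nx sgn
  W_nodup := (nodup_elemsAt m 0).map elemName_injective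
  X_nodup := (nodup_elemsAt m 1).map elemName_injective
  Y_nodup := (nodup_elemsAt m 2).map elemName_injective
  M_nodup := (nodup_labels m).map
    (Injective.of_comp (f := tripleSet) (tripleSet_injective nx sgn))
  M_subset := by
    intro t ht
    obtain ⟨l, -, rfl⟩ := List.mem_map.1 ht
    obtain ⟨h0, h1, h2⟩ := coord_labelTriple nx sgn l
    exact ⟨List.mem_map_of_mem (mem_elemsAt.2 h0), List.mem_map_of_mem (mem_elemsAt.2 h1),
      List.mem_map_of_mem (mem_elemsAt.2 h2)⟩

/-- The instance of exact cover by 3-sets. -/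
def coverInstance : X3CInstance where
  U := (elemsAt m 0 ++ elemsAt m 1 ++ elemsAt m 2).map elemName
  S := tripleList nx sgn
  U_nodup := by
    refine List.Nodup.map elemName_injective ?_
    refine List.Nodup.append (List.Nodup.append (nodup_elemsAt m 0) (nodup_elemsAt m 1) ?_)
      (nodup_elemsAt m 2) ?_
    · intro e h h'
      rw [mem_elemsAt] at h h'
      rw [h] at h'
      exact absurd h' (by decide)
    · intro e h h'
      rw [List.mem_append, mem_elemsAt, mem_elemsAt] at h
      rw [mem_elemsAt] at h'
      rw [h'] at h
      exact absurd h (by decide)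
  three_dvd := by
    simp only [List.length_map, List.length_append, length_elemsAt]
    omega
  S_nodup := by
    rw [tripleList, List.map_map]
    exact (nodup_labels m).map (tripleSet_injective nx sgn)
  S_card := by
    intro t ht
    obtain ⟨l, -, rfl⟩ := List.mem_map.1 ht
    obtain ⟨h0, h1, h2⟩ := coord_labelTriple nx sgn l
    -- The three entries are distinct because their coordinates are.
    refine Finset.card_eq_three.2 ⟨_, _, _, ?_, ?_, ?_, rfl⟩ <;>
      refine elemName_injective.ne fun h => ?_ <;> simp [h] at h0 h1 h2 <;> simp_all
  S_subset := by
    intro t ht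
    obtain ⟨l, -, rfl⟩ := List.mem_map.1 ht
    obtain ⟨h0, h1, h2⟩ := coord_labelTriple nx sgn l
    intro u hu
    have hmem : ∀ e : Elem m, e ∈ elemsAt m 0 ++ elemsAt m 1 ++ elemsAt m 2 := by
      intro e
      simp only [List.mem_append, mem_elemsAt]
      generalize coord e.2 = k
      fin_cases k <;> simp
    rw [List.mem_toFinset]
    simp only [tripleSet, nameTriple, Finset.mem_insert, Finset.mem_singleton] at hu
    rcases hu with rfl | rfl | rfl <;> exact List.mem_map_of_mem (hmem _)

/-- Used to pass from unique triples or 3-sets to unique labels. -/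
theorem existsUnique_mem_image {α β : Type} {f : α → β} (hf : Injective f) {M : Set β}
    (hM : M ⊆ Set.range f) (R : β → Prop) :
    (∃! t, t ∈ M ∧ R t) ↔ ∃! l, f l ∈ M ∧ R (f l) := by
  constructor
  · rintro ⟨t, ⟨ht, hR⟩, hu⟩
    obtain ⟨l, rfl⟩ := hM ht
    exact ⟨l, ⟨ht, hR⟩, fun l' h => hf (hu _ h)⟩
  · rintro ⟨l, h, hu⟩
    refine ⟨f l, h, ?_⟩
    rintro t ⟨ht, hR⟩
    obtain ⟨l', rfl⟩ := hM ht
    rw [hu l' ⟨ht, hR⟩]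

/-- Labels and listed 3-sets correspond bijectively, so subcollections pull back to sets of labels
and conversely; covering `U` means covering all elements, since each has one of the three
coordinates. -/
theorem hasExactCover_iff :
    (coverInstance nx sgn).HasExactCover ↔ ∃ Z, IsCover nx sgn Z := by
  classical
  have hinj := tripleSet_injective nx sgn
  set f := fun l : Label m => tripleSet (nameTriple (labelTriple nx sgn l)) with hf
  have hS : ((coverInstance nx sgn).S.map tripleSet).toFinset = (labels m).toFinset.image f := by
    ext; simp [coverInstance, tripleList, hf]
  have key : ∀ S' : Finset (Finset Name), S' ⊆ (labels m).toFinset.image f →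
      ((∀ u ∈ (coverInstance nx sgn).U, ∃! s, s ∈ S' ∧ u ∈ s) ↔
        IsCover nx sgn {l | f l ∈ S'}) := by
    intro S' hS'
    have hr : (S' : Set (Finset Name)) ⊆ Set.range f := fun t ht => by
      obtain ⟨l, -, rfl⟩ := Finset.mem_image.1 (hS' ht)
      exact ⟨l, rfl⟩
    have he : ∀ e : Elem m, (∃! s, s ∈ S' ∧ elemName e ∈ s) ↔
        ∃! l, l ∈ {l | f l ∈ S'} ∧ InTriple e (labelTriple nx sgn l) := fun e => by
      have := existsUnique_mem_image hinj hr (fun s => elemName e ∈ s)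
      simpa only [hf, mem_tripleSet_nameTriple, Finset.mem_coe, Set.mem_ofPred_eq] using this
    have hmem : ∀ e : Elem m, elemName e ∈ (coverInstance nx sgn).U := by
      intro e
      refine List.mem_map_of_mem ?_
      simp only [List.mem_append, mem_elemsAt]
      generalize coord e.2 = k
      fin_cases k <;> simp
    constructor
    · exact fun h e => (he e).1 (h _ (hmem e))
    · intro h u hu
      obtain ⟨e, -, rfl⟩ := List.mem_map.1 hu
      exact (he e).2 (h e)
  unfold X3CInstance.HasExactCover
  rw [hS]
  constructor
  · rintro ⟨S', hS', h⟩
    exact ⟨_, (key S' hS').1 h⟩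
  · rintro ⟨Z, hZ⟩
    have hsub : ((labels m).toFinset.filter (· ∈ Z)).image f ⊆ (labels m).toFinset.image f :=
      Finset.image_subset_image (Finset.filter_subset _ _)
    refine ⟨_, hsub, (key _ hsub).2 ?_⟩
    convert hZ using 1
    ext l
    simp [hinj.eq_iff, mem_labels]

/-- An element of coordinate `k` can occur in a triple only as its `k`-th entry. Hence the three
coordinatewise conditions together say that every element lies in exactly one chosen triple. -/
theorem hasPerfectMatching_iff :
    (matchingInstance nx sgn).HasPerfectMatching ↔ ∃ Z, IsCover nx sgn Z := by
  classical
  set f := fun l : Label m => nameTriple (labelTriple nx sgn l) with hf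
  have hinj : Injective f := Injective.of_comp (f := tripleSet) (tripleSet_injective nx sgn)
  have hM : (matchingInstance nx sgn).M.toFinset = (labels m).toFinset.image f := by
    ext; simp [matchingInstance, tripleList, hf]
  have key : ∀ M' : Finset Triple, M' ⊆ (labels m).toFinset.image f →
      (((∀ w ∈ (matchingInstance nx sgn).W, ∃! t, t ∈ M' ∧ t.1 = w) ∧
        (∀ x ∈ (matchingInstance nx sgn).X, ∃! t, t ∈ M' ∧ t.2.1 = x) ∧
        (∀ y ∈ (matchingInstance nx sgn).Y, ∃! t, t ∈ M' ∧ t.2.2 = y)) ↔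
        IsCover nx sgn {l | f l ∈ M'}) := by
    intro M' hM'
    have hr : (M' : Set Triple) ⊆ Set.range f := fun t ht => by
      obtain ⟨l, -, rfl⟩ := Finset.mem_image.1 (hM' ht)
      exact ⟨l, rfl⟩
    have hcase : ∀ e : Elem m, (coord e.2 = 0 → ((∃! t, t ∈ M' ∧ t.1 = elemName e) ↔
          ∃! l, l ∈ {l | f l ∈ M'} ∧ InTriple e (labelTriple nx sgn l))) ∧
        (coord e.2 = 1 → ((∃! t, t ∈ M' ∧ t.2.1 = elemName e) ↔
          ∃! l, l ∈ {l | f l ∈ M'} ∧ InTriple e (labelTriple nx sgn l))) ∧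
        (coord e.2 = 2 → ((∃! t, t ∈ M' ∧ t.2.2 = elemName e) ↔
          ∃! l, l ∈ {l | f l ∈ M'} ∧ InTriple e (labelTriple nx sgn l))) := by
      intro e
      refine ⟨fun h => ?_, fun h => ?_, fun h => ?_⟩
      · refine (existsUnique_mem_image hinj hr (fun t => t.1 = elemName e)).trans
          (existsUnique_congr fun l => and_congr Iff.rfl ?_)
        obtain ⟨h0, h1, h2⟩ := coord_labelTriple nx sgn l
        simp only [hf, nameTriple, elemName_injective.eq_iff, InTriple]
        grind
      · refine (existsUnique_mem_image hinj hr (fun t => t.2.1 = elemName e)).trans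
          (existsUnique_congr fun l => and_congr Iff.rfl ?_)
        obtain ⟨h0, h1, h2⟩ := coord_labelTriple nx sgn l
        simp only [hf, nameTriple, elemName_injective.eq_iff, InTriple]
        grind
      · refine (existsUnique_mem_image hinj hr (fun t => t.2.2 = elemName e)).trans
          (existsUnique_congr fun l => and_congr Iff.rfl ?_)
        obtain ⟨h0, h1, h2⟩ := coord_labelTriple nx sgn l
        simp only [hf, nameTriple, elemName_injective.eq_iff, InTriple]
        grind
    constructor
    · rintro ⟨hW, hX, hY⟩ e
      obtain ⟨h0, h1, h2⟩ := hcase e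
      have : coord e.2 = 0 ∨ coord e.2 = 1 ∨ coord e.2 = 2 := by
        generalize coord e.2 = k
        fin_cases k <;> simp
      rcases this with h | h | h
      · exact (h0 h).1 (hW _ (List.mem_map_of_mem (mem_elemsAt.2 h)))
      · exact (h1 h).1 (hX _ (List.mem_map_of_mem (mem_elemsAt.2 h)))
      · exact (h2 h).1 (hY _ (List.mem_map_of_mem (mem_elemsAt.2 h)))
    · intro h
      refine ⟨fun w hw => ?_, fun x hx => ?_, fun y hy => ?_⟩
      · obtain ⟨e, he, rfl⟩ := List.mem_map.1 hw
        exact ((hcase e).1 (mem_elemsAt.1 he)).2 (h e)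
      · obtain ⟨e, he, rfl⟩ := List.mem_map.1 hx
        exact ((hcase e).2.1 (mem_elemsAt.1 he)).2 (h e)
      · obtain ⟨e, he, rfl⟩ := List.mem_map.1 hy
        exact ((hcase e).2.2 (mem_elemsAt.1 he)).2 (h e)
  unfold ThreeDMInstance.HasPerfectMatching
  rw [hM]
  constructor
  · rintro ⟨M', hM', h⟩
    exact ⟨_, (key M' hM').1 h⟩
  · rintro ⟨Z, hZ⟩
    have hsub : ((labels m).toFinset.filter (· ∈ Z)).image f ⊆ (labels m).toFinset.image f :=
      Finset.image_subset_image (Finset.filter_subset _ _)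
    refine ⟨_, hsub, (key _ hsub).2 ?_⟩
    convert hZ using 1
    ext l
    simp [hinj.eq_iff, mem_labels]

end Instances

/-! ### The reduction on formulas -/

def Clause.literal (c : Clause) : Fin 3 → Literal := ![c.fst, c.snd, c.thd]

theorem Clause.holds_iff (a : Name → Bool) (c : Clause) :
    c.Holds a ↔ ∃ q, a (c.literal q).var = (c.literal q).sign := by
  simp [Clause.Holds, Literal.Holds, Clause.literal, Fin.exists_fin_succ]

variable (φ : List Clause)

def occLiteral (o : Occ φ.length) : Literal := (φ.get o.1).literal o.2

def occNext : Occ φ.length → Occ φ.length :=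
  cycNext (occs φ.length) fun o => (occLiteral φ o).var

def occSign (o : Occ φ.length) : Bool := (occLiteral φ o).sign

theorem isYes_iff_exists_isCover :
    threeSAT.IsYes φ ↔ ∃ Z, IsCover (occNext φ) (occSign φ) Z := by
  refine Iff.trans ?_ (exists_isCover_iff (var := fun o => (occLiteral φ o).var)
    (Finite.injective_iff_bijective.1 (cycNext_injective mem_occs)) (fun o => var_cycNext (var := fun o => (occLiteral φ o).var) mem_occs o)
    (fun o o' h => exists_iterate_cycNext mem_occs (nodup_occs _) h)).symm
  refine exists_congr fun a => ?_
  rw [List.forall_mem_iff_get]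
  simp only [Clause.holds_iff]
  rfl

/-! ### Implementation: the reduction as a stack program, with running time. -/

/-! ### Derived programs -/

section Derived

variable {K : Type} [DecidableEq K]

theorem Exec.congr {p : Prog K} {s s' s'' : Stacks K} {t : ℕ} (h : Exec p s t s')
    (hs : s' = s'') : Exec p s t s'' := hs ▸ h

def isBit : Option Symbol → Bool
  | some (.bit _) => true
  | _ => false

/-- Move the bits on top of `k` to all stacks in `ks`. -/
def moveBits (k : K) (ks : List K) : Prog K := .loop k k (fun o _ => isBit o) (.move k ks)

/-- Move the whole stack `k` to all stacks in `ks`. -/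
def drain (k : K) (ks : List K) : Prog K := .loop k k (fun o _ => o.isSome) (.move k ks)

/-- The stacks after moving the symbols `l` from `k`, where `rest` remains, to `ks`. -/
def moveTo (k : K) (ks : List K) (l rest : List Symbol) (s : Stacks K) : Stacks K := fun x =>
  if x = k then rest else if x ∈ ks then l.reverse ++ s x else s x

theorem pushAll_apply {ks : List K} (hks : ks.Nodup) (a : Symbol) (s : Stacks K) (x : K) :
    pushAll a ks s x = if x ∈ ks then a :: s x else s x := by
  induction ks generalizing s with
  | nil => rfl
  | cons k ks ih =>
    obtain ⟨h1, h2⟩ := List.nodup_cons.1 hks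
    rw [pushAll, List.foldl_cons, ← pushAll, ih h2]
    by_cases hx : x = k
    · subst hx; simp [h1]
    · simp [hx]

theorem moveStacks_cons {k : K} {ks : List K} (hks : ks.Nodup) (hk : k ∉ ks) {a : Symbol}
    {l : List Symbol} {s : Stacks K} (hs : s k = a :: l) :
    moveStacks k ks s = moveTo k ks [a] l s := by
  funext x
  simp only [moveStacks, hs, pushAll_apply hks, moveTo]
  by_cases hx : x = k
  · subst hx; simp [hk]
  · simp [hx]

theorem exec_move {k : K} {ks : List K} (hks : ks.Nodup) (hk : k ∉ ks) {a : Symbol}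
    {l : List Symbol} {s : Stacks K} (hs : s k = a :: l) :
    Exec (.move k ks) s 1 (moveTo k ks [a] l s) :=
  moveStacks_cons hks hk hs ▸ Exec.move k ks s

/-- Each symbol costs a test and a move, and one failing test ends the loop. The hypotheses say that
the test separates `l` from the top of `rest`. -/
theorem exec_loop_move {k : K} {ks : List K} (hks : ks.Nodup) (hk : k ∉ ks)
    {c : Option Symbol → Option Symbol → Bool} {l rest : List Symbol} {s : Stacks K}
    (hs : s k = l ++ rest) (hl : ∀ a ∈ l, c (some a) (some a) = true)
    (hrest : c rest.head? rest.head? = false) :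
    Exec (.loop k k c (.move k ks)) s (2 * l.length + 1) (moveTo k ks l rest s) := by
  induction l generalizing s with
  | nil =>
    rw [List.nil_append] at hs
    refine ((Exec.loop_done (by rw [hs]; exact hrest)).congr ?_)
    funext x
    by_cases hx : x = k
    · subst hx; simp [moveTo, hs]
    · simp [moveTo, hx]
  | cons a l ih =>
    refine ((Exec.loop_step (by rw [hs]; exact hl a (by simp)) (exec_move hks hk hs)
      (ih (s := moveTo k ks [a] (l ++ rest) s) (by simp [moveTo])
        fun b hb => hl b (by simp [hb]))).congr ?_).weaken (by simp; omega)
    funext x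
    by_cases hx : x = k
    · subst hx; simp [moveTo]
    · by_cases hx' : x ∈ ks <;> simp [moveTo, hx, hx']

/-- A binary word, as a word over the input alphabet. -/
def bitWord (v : List Bool) : List Symbol := v.map Symbol.bit

theorem exec_moveBits {k : K} {ks : List K} (hks : ks.Nodup) (hk : k ∉ ks) (v : List Bool)
    {rest : List Symbol} {s : Stacks K} (hs : s k = bitWord v ++ Symbol.comma :: rest) :
    Exec (moveBits k ks) s (2 * v.length + 1)
      (moveTo k ks (bitWord v) (Symbol.comma :: rest) s) := by
  have := exec_loop_move hks hk (c := fun o _ => isBit o) hs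
    (by intro a ha; obtain ⟨b, -, rfl⟩ := List.mem_map.1 ha; rfl) rfl
  simpa [moveBits, bitWord] using this

theorem exec_drain {k : K} {ks : List K} (hks : ks.Nodup) (hk : k ∉ ks) {l : List Symbol}
    {s : Stacks K} (hs : s k = l) :
    Exec (drain k ks) s (2 * l.length + 1) (moveTo k ks l [] s) :=
  exec_loop_move hks hk (by simpa using hs) (fun _ _ => rfl) rfl

def pushBits (k : K) (w : List Bool) : Prog K :=
  w.foldr (fun b p => .seq (.push k (.bit b)) p) .skip

theorem exec_pushBits (k : K) (w : List Bool) (s : Stacks K) :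
    Exec (pushBits k w) s (w.length + 1) (update s k ((bitWord w).reverse ++ s k)) := by
  induction w generalizing s with
  | nil => exact (Exec.skip s).congr (by simp [bitWord])
  | cons b w ih =>
    refine ((Exec.seq (Exec.push k (.bit b) s) (ih _)).congr ?_).weaken (by simp; omega)
    simp [bitWord]

end Derived

/-! ### The stacks of the reduction -/

/-- `D`: input and list of records; `R`, `T`: auxiliary; `O`: output, reversed; `I`, `J`: counters
of clauses; `N`: index of the next occurrence; `V`: name of a variable; `S`: sign. -/
inductive Stk where
  | D | R | T | O | I | J | N | V | S
  deriving DecidableEq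

instance : Fintype Stk where
  elems := {.D, .R, .T, .O, .I, .J, .N, .V, .S}
  complete x := by cases x <;> decide

def st (d r t o i j n v s : List Symbol) : Stacks Stk
  | .D => d
  | .R => r
  | .T => t
  | .O => o
  | .I => i
  | .J => j
  | .N => n
  | .V => v
  | .S => s

def tally (n : ℕ) : List Symbol := bitWord (List.replicate n true)

/-! ### Writing names -/

/-- Write the name consisting of `w` and the contents of the stack `k`. -/
def emitName (w : List Bool) (k : Stk) : Prog Stk :=
  .seq (pushBits .O w) <| .seq (drain k [.O, .T]) <| .seq (drain .T [k]) (.push .O .comma)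

theorem exec_emitName (w x : List Bool) {k : Stk} (hO : k ≠ .O) (hT : k ≠ .T)
    {s : Stacks Stk} (hk : s k = bitWord x) (hsT : s .T = []) :
    Exec (emitName w k) s (w.length + 4 * x.length + 4)
      (update s .O ((encodeName (w ++ x)).reverse ++ s .O)) := by
  have h1 := exec_pushBits .O w s
  have h2 := exec_drain (k := k) (ks := [.O, .T]) (by decide) (by simp [hO, hT])
    (s := update s .O ((bitWord w).reverse ++ s .O)) (l := bitWord x)
    (by rw [update_of_ne hO, hk])
  have h3 := exec_drain (k := Stk.T) (ks := [k]) (by simp) (by simp [Ne.symm hT])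
    (s := moveTo k [.O, .T] (bitWord x) [] (update s .O ((bitWord w).reverse ++ s .O)))
    (l := (bitWord x).reverse) (by simp [moveTo, Ne.symm hT, hsT])
  refine ((Exec.seq h1 (.seq h2 (.seq h3 (.push _ _ _)))).congr ?_).weaken ?_
  · funext y
    by_cases hy : y = .O
    · subst hy; simp [moveTo, encodeName, Ne.symm hO, bitWord]
    · by_cases hyk : y = k
      · subst hyk; simp [moveTo, hO, hT, hk]
      · by_cases hyT : y = .T
        · subst hyT; simp [moveTo, hsT]
        · simp [moveTo, hy, hyk, hyT]
  · simp [bitWord]; omega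

def emitNames (l : List (List Bool × Stk)) : Prog Stk :=
  l.foldr (fun e p => .seq (emitName e.1 e.2) p) .skip

theorem exec_emitNames (l : List (List Bool × Stk)) (x : Stk → List Bool) {s : Stacks Stk}
    {B : ℕ} (hl : ∀ e ∈ l, e.2 ≠ .O ∧ e.2 ≠ .T ∧ s e.2 = bitWord (x e.2) ∧
      e.1.length + 4 * (x e.2).length ≤ B) (hsT : s .T = []) :
    Exec (emitNames l) s (l.length * (B + 4) + 1)
      (update s .O ((l.flatMap fun e => encodeName (e.1 ++ x e.2)).reverse ++ s .O)) := by
  induction l generalizing s with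
  | nil => exact ((Exec.skip s).congr (by simp)).weaken (by simp)
  | cons e l ih =>
    obtain ⟨hO, hT, hk, hB⟩ := hl e (by simp)
    have h1 := exec_emitName e.1 (x e.2) hO hT hk hsT
    have h2 := ih (s := update s .O ((encodeName (e.1 ++ x e.2)).reverse ++ s .O))
      (fun e' he' => by
        obtain ⟨hO', hT', hk', hB'⟩ := hl e' (by simp [he'])
        exact ⟨hO', hT', by rw [update_of_ne hO', hk'], hB'⟩)
      (by rw [update_of_ne (by decide), hsT])
    refine ((Exec.seq h1 h2).congr ?_).weaken ?_
    · simp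
    · rw [List.length_cons, Nat.add_mul]; omega

/-! ### Searching a list of records -/

section Search

variable {ι : Type} (sg : ι → Bool) (var : ι → Name) (idx : ι → List Bool)

/-- A record: a sign, a variable, and an index written backwards. -/
def record (x : ι) : List Symbol :=
  .bit (sg x) :: (bitWord (var x) ++ .comma :: (bitWord (idx x).reverse ++ [.comma]))

theorem length_record (x : ι) :
    (record sg var idx x).length = (var x).length + (idx x).length + 3 := by
  simp [record, bitWord]; omega

def eqBits : Option Symbol → Option Symbol → Bool
  | some (.bit a), some (.bit b) => a == b
  | _, _ => false

/-- Move the common prefix of the words on `D` and `V` to `R` and `T`. -/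
def compareLoop : Prog Stk := .loop .D .V eqBits (.seq (.move .D [.R]) (.move .V [.T]))

/-- The common prefix `p` is saved on `R` and on `T`, so that both words can be rebuilt; equality of
the words is visible afterwards as both remainders being empty. -/
theorem exec_compareLoop (u v : List Bool) (rest r t o i j n s : List Symbol) :
    ∃ p u' v', u = p ++ u' ∧ v = p ++ v' ∧ (u = v ↔ u' = [] ∧ v' = []) ∧
      Exec compareLoop (st (bitWord u ++ .comma :: rest) r t o i j n (bitWord v) s)
        (3 * u.length + 1)
        (st (bitWord u' ++ .comma :: rest) ((bitWord p).reverse ++ r) ((bitWord p).reverse ++ t)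
          o i j n (bitWord v') s) := by
  induction u generalizing v r t with
  | nil =>
    refine ⟨[], [], v, rfl, rfl, by simp [eq_comm], ?_⟩
    exact (Exec.loop_done rfl).weaken (by simp)
  | cons a u ih =>
    cases v with
    | nil =>
      refine ⟨[], a :: u, [], rfl, rfl, by simp, ?_⟩
      exact (Exec.loop_done rfl).weaken (by simp)
    | cons b v =>
      by_cases hab : a = b
      · subst hab
        obtain ⟨p, u', v', hu, hv, hiff, h⟩ := ih v (.bit a :: r) (.bit a :: t)
        refine ⟨a :: p, u', v', by simp [hu], by simp [hv], by simpa using hiff, ?_⟩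
        have h1 : Exec (.move Stk.D [.R])
            (st (bitWord (a :: u) ++ .comma :: rest) r t o i j n (bitWord (a :: v)) s) 1
            (st (bitWord u ++ .comma :: rest) (.bit a :: r) t o i j n (bitWord (a :: v)) s) :=
          (Exec.move ..).congr (by funext k; cases k <;> rfl)
        have h2 : Exec (.move Stk.V [.T])
            (st (bitWord u ++ .comma :: rest) (.bit a :: r) t o i j n (bitWord (a :: v)) s) 1
            (st (bitWord u ++ .comma :: rest) (.bit a :: r) (.bit a :: t) o i j n
              (bitWord v) s) :=
          (Exec.move ..).congr (by funext k; cases k <;> rfl)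
        refine ((Exec.loop_step ?_ (h1.seq h2) h).weaken (by simp; omega)).congr ?_
        · exact beq_self_eq_true a
        · simp [bitWord]
      · refine ⟨[], a :: u, b :: v, rfl, rfl, by simp [hab], ?_⟩
        refine (Exec.loop_done ?_).weaken (by simp)
        exact beq_eq_false_iff_ne.2 hab

/-- Move one record from `D` to `R`. If its variable is the word on `V`, copy its index to `N`. -/
def searchStep : Prog Stk :=
  .seq (.move .D [.R]) <| .seq compareLoop <| .seq
    (.ite .D .V (fun d v => decide (d = some .comma) && v.isNone)
      (.seq (.move .D [.R]) (moveBits .D [.R, .N]))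
      (.seq (moveBits .D [.R]) <| .seq (.move .D [.R]) (moveBits .D [.R]))) <|
  .seq (.move .D [.R]) (drain .T [.V])

/-- Moving a word between stacks reverses it, so the index stored backwards arrives on `N` in
reading order. The word on `V` is restored from `T`, and the record is kept, reversed, on `R`. -/
theorem exec_searchStep (x : ι) (v : Name) (rest r o i j s : List Symbol) :
    Exec searchStep (st (record sg var idx x ++ rest) r [] o i j [] (bitWord v) s)
      (5 * (record sg var idx x).length + 10)
      (st rest ((record sg var idx x).reverse ++ r) [] o i j
        (if var x = v then bitWord (idx x) else []) (bitWord v) s) := by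
  obtain ⟨p, u', v', hu, hv, hiff, h2⟩ := exec_compareLoop (var x) v
    (bitWord (idx x).reverse ++ .comma :: rest) (.bit (sg x) :: r) [] o i j [] s
  have h1 : Exec (.move Stk.D [.R])
      (st (record sg var idx x ++ rest) r [] o i j [] (bitWord v) s) 1
      (st (bitWord (var x) ++ .comma :: (bitWord (idx x).reverse ++ .comma :: rest))
        (.bit (sg x) :: r) [] o i j [] (bitWord v) s) := by
    refine (exec_move (k := Stk.D) (ks := [.R]) (a := .bit (sg x)) (by decide) (by decide)
      ?_).congr (by funext k; cases k <;> rfl)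
    simp [st, record]
  set r' := (bitWord (var x)).reverse ++ .bit (sg x) :: r with hr'
  have h3 : Exec (.ite Stk.D .V (fun d v => decide (d = some .comma) && v.isNone)
      (.seq (.move .D [.R]) (moveBits .D [.R, .N]))
      (.seq (moveBits .D [.R]) <| .seq (.move .D [.R]) (moveBits .D [.R])))
      (st (bitWord u' ++ .comma :: (bitWord (idx x).reverse ++ .comma :: rest))
        ((bitWord p).reverse ++ .bit (sg x) :: r) ((bitWord p).reverse ++ []) o i j []
        (bitWord v') s)
      (2 * u'.length + 2 * (idx x).length + 4)
      (st (.comma :: rest) (bitWord (idx x) ++ .comma :: r') ((bitWord p).reverse) o i j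
        (if var x = v then bitWord (idx x) else []) (bitWord v') s) := by
    by_cases hm : var x = v
    · obtain ⟨rfl, rfl⟩ := hiff.1 hm
      have ha : Exec (.move Stk.D [.R]) (st (.comma :: (bitWord (idx x).reverse ++
          .comma :: rest)) r' ((bitWord p).reverse) o i j [] [] s) 1
          (st (bitWord (idx x).reverse ++ .comma :: rest) (.comma :: r') ((bitWord p).reverse)
            o i j [] [] s) :=
        (Exec.move ..).congr (by funext k; cases k <;> rfl)
      have hb := exec_moveBits (k := Stk.D) (ks := [.R, .N]) (by decide) (by decide)
        (idx x).reverse (rest := rest) (s := st (bitWord (idx x).reverse ++ .comma :: rest)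
          (.comma :: r') ((bitWord p).reverse) o i j [] [] s) rfl
      rw [List.append_nil] at hu
      rw [← hu, List.append_nil, ← hu] at *
      refine ((Exec.ite_true rfl (ha.seq hb)).congr ?_).weaken (by simp; omega)
      rw [if_pos hm]
      funext k; cases k <;> simp [moveTo, st, bitWord]
    · have hne : ¬ (u' = [] ∧ v' = []) := fun h => hm (hiff.2 h)
      have ha := exec_moveBits (k := Stk.D) (ks := [.R]) (by decide) (by decide)
        u' (rest := bitWord (idx x).reverse ++ .comma :: rest)
        (s := st (bitWord u' ++ .comma :: (bitWord (idx x).reverse ++ .comma :: rest))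
          ((bitWord p).reverse ++ .bit (sg x) :: r) ((bitWord p).reverse ++ []) o i j []
          (bitWord v') s) rfl
      have hb := exec_move (k := Stk.D) (ks := [.R]) (by decide) (by decide) (a := .comma)
        (l := bitWord (idx x).reverse ++ .comma :: rest)
        (s := moveTo .D [.R] (bitWord u')
          (.comma :: (bitWord (idx x).reverse ++ .comma :: rest))
          (st (bitWord u' ++ .comma :: (bitWord (idx x).reverse ++ .comma :: rest))
          ((bitWord p).reverse ++ .bit (sg x) :: r) ((bitWord p).reverse ++ []) o i j []
          (bitWord v') s)) rfl
      have hc := exec_moveBits (k := Stk.D) (ks := [.R]) (by decide) (by decide)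
        (idx x).reverse (rest := rest) (s := moveTo .D [.R] [.comma]
          (bitWord (idx x).reverse ++ .comma :: rest) (moveTo .D [.R] (bitWord u')
          (.comma :: (bitWord (idx x).reverse ++ .comma :: rest))
          (st (bitWord u' ++ .comma :: (bitWord (idx x).reverse ++ .comma :: rest))
          ((bitWord p).reverse ++ .bit (sg x) :: r) ((bitWord p).reverse ++ []) o i j []
          (bitWord v') s))) rfl
      refine ((Exec.ite_false ?_ (ha.seq (hb.seq hc))).congr ?_).weaken (by simp; omega)
      · cases u' with
        | cons b u' => rfl
        | nil =>
          cases v' with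
          | nil => exact absurd ⟨rfl, rfl⟩ hne
          | cons b v' => rfl
      · rw [if_neg hm]
        funext k; cases k <;> simp [moveTo, st, bitWord, hr', hu]
  have h4 : Exec (.move Stk.D [.R]) (st (.comma :: rest) (bitWord (idx x) ++ .comma :: r')
      ((bitWord p).reverse) o i j (if var x = v then bitWord (idx x) else []) (bitWord v') s) 1
      (st rest (.comma :: (bitWord (idx x) ++ .comma :: r'))
      ((bitWord p).reverse) o i j (if var x = v then bitWord (idx x) else []) (bitWord v') s) :=
    (Exec.move ..).congr (by funext k; cases k <;> rfl)
  have h5 := exec_drain (k := Stk.T) (ks := [.V]) (by decide) (by decide)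
    (s := (st rest (.comma :: (bitWord (idx x) ++ .comma :: r'))
      ((bitWord p).reverse) o i j (if var x = v then bitWord (idx x) else []) (bitWord v') s))
    (l := (bitWord p).reverse) rfl
  refine ((h1.seq (h2.seq (h3.seq (h4.seq h5)))).congr ?_).weaken ?_
  · funext k; cases k <;> simp [moveTo, st, record, hr', hv, bitWord]
  · have := congrArg List.length hu
    rw [length_record]
    simp [bitWord] at this ⊢
    omega

/-- Find the first record on `D` whose variable is the word on `V`, and copy its index to `N`. -/
def search : Prog Stk :=
  .seq (.loop .N .N (fun o _ => o.isNone) searchStep) (drain .R [.D])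

variable {sg var idx}

/-- `N` doubles as the flag that a match was found; this is why indices have to be nonempty. -/
theorem exec_searchLoop (hidx : ∀ x, idx x ≠ []) {X : List ι} {v : Name} {y : ι} {B : ℕ}
    (hX : X.find? (fun x => decide (var x = v)) = some y)
    (hB : ∀ x ∈ X, (record sg var idx x).length ≤ B) (rest r o i j s : List Symbol) :
    ∃ X₁ X₂, X = X₁ ++ X₂ ∧ Exec (.loop .N .N (fun o _ => o.isNone) searchStep)
      (st (X.flatMap (record sg var idx) ++ rest) r [] o i j [] (bitWord v) s)
      (X.length * (5 * B + 11) + 1)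
      (st (X₂.flatMap (record sg var idx) ++ rest)
        ((X₁.flatMap (record sg var idx)).reverse ++ r) [] o i j (bitWord (idx y))
        (bitWord v) s) := by
  induction X generalizing r with
  | nil => simp at hX
  | cons x X ih =>
    have h := exec_searchStep sg var idx x v (X.flatMap (record sg var idx) ++ rest) r o i j s
    have hBx := hB x (by simp)
    rw [List.flatMap_cons, List.append_assoc, List.length_cons, Nat.add_mul]
    by_cases hx : var x = v
    · rw [List.find?_cons_of_pos (by simpa using hx)] at hX
      obtain rfl := Option.some.inj hX
      rw [if_pos hx] at h
      refine ⟨[x], X, rfl, ((Exec.loop_step rfl h (.loop_done ?_)).congr (by simp)).weaken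
        (by omega)⟩
      have := hidx x
      cases hi : idx x with
      | nil => exact absurd hi this
      | cons => rfl
    · rw [List.find?_cons_of_neg (by simpa using hx)] at hX
      rw [if_neg hx] at h
      obtain ⟨X₁, X₂, hXX, h'⟩ := ih hX (fun z hz => hB z (by simp [hz]))
        ((record sg var idx x).reverse ++ r)
      refine ⟨x :: X₁, X₂, by simp [hXX], ((Exec.loop_step rfl h h').congr (by simp)).weaken
        (by omega)⟩

theorem length_flatMap_le {α β : Type} {f : α → List β} {X : List α} {B : ℕ}
    (hB : ∀ x ∈ X, (f x).length ≤ B) : (X.flatMap f).length ≤ X.length * B := by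
  rw [List.length_flatMap]
  refine (List.sum_le_card_nsmul _ B ?_).trans (by simp)
  intro n hn
  obtain ⟨x, hx, rfl⟩ := List.mem_map.1 hn
  exact hB x hx

theorem exec_search (hidx : ∀ x, idx x ≠ []) {X : List ι} {v : Name} {y : ι} {B : ℕ}
    (hX : X.find? (fun x => decide (var x = v)) = some y)
    (hB : ∀ x ∈ X, (record sg var idx x).length ≤ B) (rest o i j s : List Symbol) :
    Exec search
      (st (X.flatMap (record sg var idx) ++ rest) [] [] o i j [] (bitWord v) s)
      (X.length * (7 * B + 11) + 2)
      (st (X.flatMap (record sg var idx) ++ rest) [] [] o i j (bitWord (idx y))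
        (bitWord v) s) := by
  obtain ⟨X₁, X₂, rfl, h⟩ := exec_searchLoop hidx hX hB rest [] o i j s
  have h2 := exec_drain (k := Stk.R) (ks := [.D]) (by decide) (by decide)
    (s := st (X₂.flatMap (record sg var idx) ++ rest)
        ((X₁.flatMap (record sg var idx)).reverse ++ []) [] o i j (bitWord (idx y))
        (bitWord v) s) rfl
  refine ((h.seq h2).congr ?_).weaken ?_
  · funext k; cases k <;> simp [moveTo, st]
  · have h3 := length_flatMap_le fun x hx => hB x (List.mem_append_left X₂ hx)
    rw [List.length_append]
    simp only [st, List.append_nil, List.length_reverse]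
    nlinarith
end Search

/-! ### Writing the triples -/

/-- The index of an occurrence, as it appears at the end of names. -/
def indexWord (q : Fin 3) (i : ℕ) : List Bool := bits q ++ List.replicate i true

/-- The names in the triple of a gadget: a binary word and the stack with the rest of the name. -/
def gadgetSpec (q : Fin 3) (σ : Bool) :
    Gadget → (List Bool × Stk) × (List Bool × Stk) × (List Bool × Stk)
  | .wheel r β => rotate r
      (if β then (tagName (r, .a q), .I) else (bits r ++ [false, false, false], .N),
        (tagName (r, .b q), .I), (tagName (r, .tip (!β) q), .I))
  | .clause r => rotate r
      ((tagName (r, .s), .I), (tagName (r, .t), .I), (tagName (r, .tip σ q), .I))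
  | .garbage β =>
      ((tagName (1, .tip β q), .I), (tagName (2, .tip β q), .I), (tagName (0, .tip β q), .I))

def gadgetNames (q : Fin 3) (σ : Bool) : List (List Bool × Stk) :=
  gadgets.flatMap fun g =>
    [(gadgetSpec q σ g).1, (gadgetSpec q σ g).2.1, (gadgetSpec q σ g).2.2]

/-- The relevant contents of the stacks when the triples of an occurrence in the clause number `i`
are written. -/
def wordOn (i : ℕ) (w : List Bool) : Stk → List Bool
  | .I => List.replicate i true
  | .N => w
  | _ => []

/-- Apart from `a` of the next occurrence, every name ends with the current clause number, found on
`I`; its remaining bits are known to the finite control. For that exceptional element the position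
is unknown as well, and both are read from `N`. -/
theorem flatMap_gadgetNames {m : ℕ} (nx : Occ m → Occ m) (sgn : Occ m → Bool) (o : Occ m) :
    ((gadgetNames o.2 (sgn o)).flatMap fun e =>
      encodeName (e.1 ++ wordOn o.1 (indexWord (nx o).2 (nx o).1) e.2)) =
    gadgets.flatMap fun g => encodeTriple (nameTriple (labelTriple nx sgn (o, g))) := by
  rw [gadgetNames, List.flatMap_assoc]
  congr 1
  funext g
  have hr : ∀ r : Fin 3, r = 0 ∨ r = 1 ∨ r = 2 := by decide
  rcases g with ⟨r, _ | _⟩ | r | β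
  · rcases hr r with rfl | rfl | rfl <;>
      simp [gadgetSpec, labelTriple, gadgetTriple, rotate, encodeTriple, nameTriple, elemName,
        wordOn, tagName, indexWord, Part.kind, Part.position]
  · rcases hr r with rfl | rfl | rfl <;>
      simp [gadgetSpec, labelTriple, gadgetTriple, rotate, encodeTriple, nameTriple, elemName,
        wordOn]
  · rcases hr r with rfl | rfl | rfl <;>
      simp [gadgetSpec, labelTriple, gadgetTriple, rotate, encodeTriple, nameTriple, elemName,
        wordOn]
  · simp [gadgetSpec, labelTriple, gadgetTriple, encodeTriple, nameTriple, elemName, wordOn]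

theorem gadgetNames_spec : ∀ (q : Fin 3) (σ : Bool), (gadgetNames q σ).length = 33 ∧
    ∀ e ∈ gadgetNames q σ, (e.2 = .I ∨ e.2 = .N) ∧ e.1.length ≤ 7 := by
  decide

/-- Process the first record on `D`, which belongs to the position `q` of a clause. -/
def occStep (q : Fin 3) : Prog Stk :=
  .seq (.move .D [.S]) <| .seq (moveBits .D [.T]) <| .seq (drain .T [.V]) <|
  .seq (.move .D []) <| .seq (moveBits .D []) <| .seq (.move .D []) <| .seq search <|
  .seq (.ite .S .S (fun o _ => decide (o = some (.bit true)))
    (emitNames (gadgetNames q true)) (emitNames (gadgetNames q false))) <|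
  .seq (drain .V []) <| .seq (drain .N []) (.move .S [])

theorem exec_emit_gadgetNames (q : Fin 3) (σ : Bool) (i : ℕ) (w : List Bool) (B : ℕ)
    (hi : i ≤ B) (hw : w.length ≤ B) (d o j v : List Symbol) :
    Exec (.ite .S .S (fun o _ => decide (o = some (.bit true)))
      (emitNames (gadgetNames q true)) (emitNames (gadgetNames q false)))
      (st d [] [] o (tally i) j (bitWord w) v [.bit σ]) (132 * B + 365)
      (st d [] [] (((gadgetNames q σ).flatMap fun e =>
        encodeName (e.1 ++ wordOn i w e.2)).reverse ++ o) (tally i) j (bitWord w) v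
        [.bit σ]) := by
  have h : Exec (emitNames (gadgetNames q σ))
      (st d [] [] o (tally i) j (bitWord w) v [.bit σ]) (132 * B + 364)
      (st d [] [] (((gadgetNames q σ).flatMap fun e =>
        encodeName (e.1 ++ wordOn i w e.2)).reverse ++ o) (tally i) j (bitWord w) v
        [.bit σ]) := by
    obtain ⟨hlen, hspec⟩ := gadgetNames_spec q σ
    -- A name has at most `7` fixed bits and a suffix of length at most `B`, costing `4` steps per
    -- symbol of the suffix; there are `33` names.
    refine ((exec_emitNames (gadgetNames q σ) (wordOn i w) (B := 7 + 4 * B) ?_ rfl).congr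
      ?_).weaken (by rw [hlen]; omega)
    · intro e he
      obtain ⟨h | h, hl⟩ := hspec e he <;> rw [h]
      · refine ⟨by decide, by decide, rfl, ?_⟩
        simp only [wordOn, List.length_replicate]
        omega
      · refine ⟨by decide, by decide, rfl, ?_⟩
        simp only [wordOn]
        omega
    · funext k; cases k <;> rfl
  cases σ with
  | true => exact .ite_true rfl h
  | false => exact .ite_false rfl h

section Formula

variable (φ : List Clause)

def occIndex (o : Occ φ.length) : List Bool := indexWord o.2 o.1

/-- The record of an occurrence. -/
def occRecord (o : Occ φ.length) : List Symbol :=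
  record (occSign φ) (fun o => (occLiteral φ o).var) (occIndex φ) o

def occTriples (o : Occ φ.length) : List Symbol :=
  gadgets.flatMap fun g => encodeTriple (nameTriple (labelTriple (occNext φ) (occSign φ) (o, g)))

variable {φ}

theorem length_occRecord (o : Occ φ.length) :
    (occRecord φ o).length = (occLiteral φ o).var.length + o.1 + 5 := by
  rw [occRecord, length_record]
  simp [occIndex, indexWord, bits]
  omega

/-- Once the current record is removed, `D` holds `post ++ occs`, the list in which, by
`find?_cycNext`, the first record with the same variable is the cyclic successor. The index in the
removed record is discarded: the position is known to the control and the clause number is on `I`.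
-/
theorem exec_occStep {B : ℕ} (hB : ∀ o, (occRecord φ o).length ≤ B)
    {pre post : List (Occ φ.length)} {o : Occ φ.length} (ho : occs φ.length = pre ++ o :: post)
    (out j : List Symbol) :
    Exec (occStep o.2)
      (st ((o :: post ++ occs φ.length).flatMap (occRecord φ)) [] [] out (tally o.1) j [] [] [])
      (6 * φ.length * (7 * B + 11) + 142 * B + 380)
      (st ((post ++ occs φ.length).flatMap (occRecord φ)) [] []
        ((occTriples φ o).reverse ++ out) (tally o.1) j [] [] []) := by
  set v := (occLiteral φ o).var with hv
  set D := (post ++ occs φ.length).flatMap (occRecord φ) with hD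
  have h1 : Exec (.move Stk.D [.S])
      (st ((o :: post ++ occs φ.length).flatMap (occRecord φ)) [] [] out (tally o.1) j [] [] []) 1
      (st (bitWord v ++ .comma :: (bitWord (occIndex φ o).reverse ++ .comma :: D))
        [] [] out (tally o.1) j [] [] [.bit (occSign φ o)]) := by
    refine (exec_move (k := Stk.D) (ks := [.S]) (a := .bit (occSign φ o)) (by decide)
      (by decide) ?_).congr (by funext k; cases k <;> rfl)
    simp [st, occRecord, record, D, v]
  have h2 : Exec (moveBits Stk.D [.T])
      (st (bitWord v ++ .comma :: (bitWord (occIndex φ o).reverse ++ .comma :: D))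
        [] [] out (tally o.1) j [] [] [.bit (occSign φ o)]) (2 * v.length + 1)
      (st (.comma :: (bitWord (occIndex φ o).reverse ++ .comma :: D))
        [] (bitWord v).reverse out (tally o.1) j [] [] [.bit (occSign φ o)]) :=
    (exec_moveBits (k := Stk.D) (ks := [.T]) (by decide) (by decide) v rfl).congr
      (by funext k; cases k <;> simp [moveTo, st])
  have h3 : Exec (drain Stk.T [.V])
      (st (.comma :: (bitWord (occIndex φ o).reverse ++ .comma :: D))
        [] (bitWord v).reverse out (tally o.1) j [] [] [.bit (occSign φ o)]) (2 * v.length + 1)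
      (st (.comma :: (bitWord (occIndex φ o).reverse ++ .comma :: D))
        [] [] out (tally o.1) j [] (bitWord v) [.bit (occSign φ o)]) :=
    ((exec_drain (k := Stk.T) (ks := [.V]) (l := (bitWord v).reverse) (by decide) (by decide) rfl).congr
      (by funext k; cases k <;> simp [moveTo, st])).weaken (by simp [bitWord])
  have h4 : Exec (.move Stk.D [])
      (st (.comma :: (bitWord (occIndex φ o).reverse ++ .comma :: D))
        [] [] out (tally o.1) j [] (bitWord v) [.bit (occSign φ o)]) 1
      (st (bitWord (occIndex φ o).reverse ++ .comma :: D)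
        [] [] out (tally o.1) j [] (bitWord v) [.bit (occSign φ o)]) :=
    (Exec.move ..).congr (by funext k; cases k <;> rfl)
  have h5 : Exec (moveBits Stk.D [])
      (st (bitWord (occIndex φ o).reverse ++ .comma :: D)
        [] [] out (tally o.1) j [] (bitWord v) [.bit (occSign φ o)])
      (2 * (occIndex φ o).length + 1)
      (st (.comma :: D)
        [] [] out (tally o.1) j [] (bitWord v) [.bit (occSign φ o)]) :=
    ((exec_moveBits (k := Stk.D) (ks := []) (by decide) (by decide) (occIndex φ o).reverse rfl).congr
      (by funext k; cases k <;> simp [moveTo, st])).weaken (by simp)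
  have h6 : Exec (.move Stk.D [])
      (st (.comma :: D) [] [] out (tally o.1) j [] (bitWord v) [.bit (occSign φ o)]) 1
      (st D [] [] out (tally o.1) j [] (bitWord v) [.bit (occSign φ o)]) :=
    (Exec.move ..).congr (by funext k; cases k <;> rfl)
  have h7 : Exec search
      (st D [] [] out (tally o.1) j [] (bitWord v) [.bit (occSign φ o)])
      (6 * φ.length * (7 * B + 11) + 2)
      (st D [] [] out (tally o.1) j (bitWord (occIndex φ (occNext φ o))) (bitWord v)
        [.bit (occSign φ o)]) := by
    have h := exec_search (sg := occSign φ) (var := fun o => (occLiteral φ o).var)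
      (idx := occIndex φ) (fun x => by simp [occIndex, indexWord, bits])
      (find?_cycNext (var := fun o => (occLiteral φ o).var) (nodup_occs _) ho)
      (fun x _ => hB x) [] out (tally o.1) j [.bit (occSign φ o)]
    rw [List.append_nil] at h
    refine h.weaken ?_
    -- Both parts have at most `3 * φ.length` entries.
    have hlen : (post ++ occs φ.length).length ≤ 6 * φ.length := by
      have h1 := length_occs φ.length
      have h2 := congrArg List.length ho
      simp only [List.length_append, List.length_cons] at h2 ⊢
      omega
    exact Nat.add_le_add_right (Nat.mul_le_mul_right _ hlen) 2
  have hBo := hB o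
  have hBn := hB (occNext φ o)
  rw [length_occRecord] at hBo hBn
  rw [← hv] at hBo
  have hidx : ∀ o, (occIndex φ o).length = o.1 + 2 := fun o => by
    simp [occIndex, indexWord, bits]
  have h8 := exec_emit_gadgetNames o.2 (occSign φ o) o.1 (occIndex φ (occNext φ o)) B
    (by omega) (by rw [hidx]; omega) D out j (bitWord v)
  rw [show occIndex φ (occNext φ o) = indexWord (occNext φ o).2 (occNext φ o).1 from rfl,
    flatMap_gadgetNames] at h8
  have h9 := exec_drain (k := Stk.V) (ks := []) (by decide) (by decide) (l := bitWord v)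
    (s := st D [] [] ((occTriples φ o).reverse ++ out) (tally o.1) j
      (bitWord (occIndex φ (occNext φ o))) (bitWord v) [.bit (occSign φ o)]) rfl
  have h10 : Exec (drain Stk.N []) _ _
      (st D [] [] ((occTriples φ o).reverse ++ out) (tally o.1) j [] [] [.bit (occSign φ o)]) :=
    (exec_drain (k := Stk.N) (ks := []) (by decide) (by decide)
    (l := bitWord (occIndex φ (occNext φ o)))
    (s := moveTo .V [] (bitWord v) [] (st D [] [] ((occTriples φ o).reverse ++ out) (tally o.1) j
      (bitWord (occIndex φ (occNext φ o))) (bitWord v) [.bit (occSign φ o)])) rfl).congr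
      (by funext k; cases k <;> rfl)
  have h11 : Exec (.move Stk.S []) _ 1
      (st D [] [] ((occTriples φ o).reverse ++ out) (tally o.1) j [] [] []) :=
    (Exec.move Stk.S [] (st D [] [] ((occTriples φ o).reverse ++ out) (tally o.1) j [] []
      [.bit (occSign φ o)])).congr (by funext k; cases k <;> rfl)
  refine (h1.seq <| h2.seq <| h3.seq <| h4.seq <| h5.seq <| h6.seq <| h7.seq <| h8.seq <|
    h9.seq <| h10.seq h11).weaken ?_
  have hvB : v.length + 5 ≤ B := by omega
  have := hidx o
  have := hidx (occNext φ o)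
  simp only [bitWord, List.length_map]
  omega

/-- Process all clauses. -/
def triplePass : Prog Stk :=
  .loop .J .J (fun o _ => o.isSome) <|
  .seq (occStep 0) <| .seq (occStep 1) <| .seq (occStep 2) (.move .J [.I])

def clauseOccs {m : ℕ} (i : Fin m) : List (Occ m) := [(i, 0), (i, 1), (i, 2)]

theorem occs_eq (m : ℕ) : occs m = (List.finRange m).flatMap clauseOccs := rfl

theorem val_eq_length_of_finRange {m : ℕ} {pre post : List (Fin m)} {i : Fin m}
    (h : List.finRange m = pre ++ i :: post) : (i : ℕ) = pre.length := by
  have hlt : pre.length < (List.finRange m).length := by rw [h]; simp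
  have h1 : (List.finRange m)[pre.length] = i := by simp [h]
  rw [List.getElem_finRange] at h1
  rw [← h1]; rfl

theorem tally_succ (n : ℕ) : tally (n + 1) = .bit true :: tally n := rfl

/-- Invariant: `I` and `J` count the clauses done and still to do, so `I` is the number of the
current clause in unary. The second copy of the records is never consumed and makes wrapping around
possible until the end. -/
theorem exec_triplePass_aux {B : ℕ} (hB : ∀ o, (occRecord φ o).length ≤ B)
    {pre post : List (Fin φ.length)} (h : List.finRange φ.length = pre ++ post)
    (out : List Symbol) :
    Exec triplePass
      (st ((post.flatMap clauseOccs ++ occs φ.length).flatMap (occRecord φ)) [] [] out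
        (tally pre.length) (tally post.length) [] [] [])
      (post.length * (3 * (6 * φ.length * (7 * B + 11) + 142 * B + 380) + 2) + 1)
      (st ((occs φ.length).flatMap (occRecord φ)) [] []
        (((post.flatMap clauseOccs).flatMap (occTriples φ)).reverse ++ out)
        (tally φ.length) [] [] [] []) := by
  induction post generalizing pre out with
  | nil =>
    have hlen : φ.length = pre.length := by
      have := congrArg List.length h
      simpa using this
    refine ((Exec.loop_done rfl).congr ?_).weaken (by simp)
    have ht : tally pre.length = tally φ.length := congrArg tally hlen.symm
    rw [ht]; rfl
  | cons i post ih =>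
    have hi := val_eq_length_of_finRange h
    set P := pre.flatMap clauseOccs with hP
    set Q := post.flatMap clauseOccs with hQ
    have ho : occs φ.length = P ++ (i, 0) :: (i, 1) :: (i, 2) :: Q := by
      rw [occs_eq, h]; simp [clauseOccs, P, Q]
    have e0 := exec_occStep hB (pre := P) (o := (i, 0)) ho out (tally (post.length + 1))
    have e1 := exec_occStep hB (pre := P ++ [(i, 0)]) (post := (i, 2) :: Q) (o := (i, 1)) (by simp [ho])
      ((occTriples φ (i, 0)).reverse ++ out) (tally (post.length + 1))
    have e2 := exec_occStep hB (pre := P ++ [(i, 0), (i, 1)]) (post := Q) (o := (i, 2)) (by simp [ho])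
      ((occTriples φ (i, 1)).reverse ++ ((occTriples φ (i, 0)).reverse ++ out))
      (tally (post.length + 1))
    have e3 : Exec (.move Stk.J [.I]) _ 1 _ := Exec.move Stk.J [.I]
      (st ((Q ++ occs φ.length).flatMap (occRecord φ)) [] [] ((occTriples φ (i, 2)).reverse ++
        ((occTriples φ (i, 1)).reverse ++ ((occTriples φ (i, 0)).reverse ++ out)))
        (tally i) (tally (post.length + 1)) [] [] [])
    have e3' := e3.congr (s'' := (st ((Q ++ occs φ.length).flatMap (occRecord φ)) [] []
      ((occTriples φ (i, 2)).reverse ++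
        ((occTriples φ (i, 1)).reverse ++ ((occTriples φ (i, 0)).reverse ++ out)))
        (tally (pre ++ [i]).length) (tally post.length) [] [] []))
        (by rw [List.length_append, ← hi]; funext k; cases k <;> rfl)
    have e4 := ih (pre := pre ++ [i]) (by simp [h]) ((occTriples φ (i, 2)).reverse ++
        ((occTriples φ (i, 1)).reverse ++ ((occTriples φ (i, 0)).reverse ++ out)))
    have e5 := Exec.loop_step (k := Stk.J) (k' := Stk.J) (c := fun o _ => o.isSome) rfl
      (e0.seq (e1.seq (e2.seq e3'))) e4
    rw [← hi]
    refine (e5.congr ?_).weaken ?_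
    · simp [clauseOccs, hQ]
    · rw [List.length_cons, Nat.add_mul (post.length) 1]; omega

theorem exec_triplePass {B : ℕ} (hB : ∀ o, (occRecord φ o).length ≤ B) (out : List Symbol) :
    Exec triplePass
      (st ((occs φ.length ++ occs φ.length).flatMap (occRecord φ)) [] [] out
        [] (tally φ.length) [] [] [])
      (φ.length * (3 * (6 * φ.length * (7 * B + 11) + 142 * B + 380) + 2) + 1)
      (st ((occs φ.length).flatMap (occRecord φ)) [] []
        (((occs φ.length).flatMap (occTriples φ)).reverse ++ out)
        (tally φ.length) [] [] [] []) := by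
  have := exec_triplePass_aux hB (pre := []) (post := List.finRange φ.length) rfl out
  rwa [← occs_eq, List.length_finRange] at this

/-! ### Reading the formula -/

/-- Move a literal from `D` to `R`, as a record whose index is taken from `I` and `q`. -/
def literalStep (q : Fin 3) : Prog Stk :=
  .seq (moveBits .D [.R]) <| .seq (.move .D [.R]) <| .seq (drain Stk.I [.R, .T]) <|
  .seq (drain Stk.T [.I]) <| .seq (pushBits .R (bits q).reverse) (.push .R .comma)

/-- The sign bit and the variable form one block of bits, moved together. `R` receives the literal
followed by the reversed index, which read from the bottom is the record. -/
theorem exec_literalStep {B : ℕ} (hB : ∀ o, (occRecord φ o).length ≤ B) (o : Occ φ.length)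
    (rest r : List Symbol) :
    Exec (literalStep o.2)
      (st (encodeLiteral (occLiteral φ o) ++ rest) r [] [] (tally o.1) [] [] [] [])
      (4 * B)
      (st rest ((occRecord φ o).reverse ++ r) [] [] (tally o.1) [] [] [] []) := by
  set l := occLiteral φ o with hl
  obtain ⟨i, hi⟩ : ∃ i : ℕ, i = o.1 := ⟨_, rfl⟩
  rw [← hi]
  set r₁ := (bitWord (l.sign :: l.var)).reverse ++ r with hr₁
  have h1 : Exec (moveBits Stk.D [.R])
      (st (encodeLiteral l ++ rest) r [] [] (tally i) [] [] [] [])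
      (2 * (l.var.length + 1) + 1)
      (st (.comma :: rest) r₁ [] [] (tally i) [] [] [] []) :=
    (exec_moveBits (by decide) (by decide) (l.sign :: l.var) (rest := rest)
      (by simp [st, encodeLiteral, encodeName, bitWord])).congr
      (by funext k; cases k <;> simp [moveTo, st, hr₁])
  have h2 : Exec (.move .D [.R]) (st (.comma :: rest) r₁ [] [] (tally i) [] [] [] []) 1
      (st rest (.comma :: r₁) [] [] (tally i) [] [] [] []) :=
    (Exec.move ..).congr (by funext k; cases k <;> rfl)
  have h3 : Exec (drain Stk.I [.R, .T]) (st rest (.comma :: r₁) [] [] (tally i) [] [] [] [])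
      (2 * i + 1) (st rest (tally i ++ .comma :: r₁) (tally i) [] [] [] [] [] []) :=
    ((exec_drain (k := Stk.I) (ks := [.R, .T]) (l := tally i) (by decide) (by decide) rfl).congr
      (by funext k; cases k <;> simp [moveTo, st, tally, bitWord])).weaken
      (by simp [tally, bitWord])
  have h4 : Exec (drain Stk.T [.I]) (st rest (tally i ++ .comma :: r₁) (tally i) [] [] [] [] [] [])
      (2 * i + 1) (st rest (tally i ++ .comma :: r₁) [] [] (tally i) [] [] [] []) :=
    ((exec_drain (k := Stk.T) (ks := [.I]) (l := tally i) (by decide) (by decide) rfl).congr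
      (by funext k; cases k <;> simp [moveTo, st, tally, bitWord])).weaken
      (by simp [tally, bitWord])
  have h5 := exec_pushBits .R (bits o.2).reverse
    (st rest (tally i ++ .comma :: r₁) [] [] (tally i) [] [] [] [])
  refine ((h1.seq <| h2.seq <| h3.seq <| h4.seq <| h5.seq (.push _ _ _)).congr ?_).weaken ?_
  · funext k
    cases k <;> simp [st, occRecord, record, occIndex, indexWord, hr₁, bitWord, tally,
      occSign, ← hl, ← hi]
  · have := hB o
    rw [length_occRecord, ← hl, ← hi] at this
    simp [bits]
    omega

/-- Move all literals from `D` to `R`, and count the clauses on `I`. -/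
def readFormula : Prog Stk :=
  .loop .D .D (fun o _ => o.isSome) <|
  .seq (literalStep 0) <| .seq (literalStep 1) <| .seq (literalStep 2) (.push .I (.bit true))

theorem exec_readFormula_aux {B : ℕ} (hB : ∀ o, (occRecord φ o).length ≤ B)
    {pre post : List (Fin φ.length)} (h : List.finRange φ.length = pre ++ post)
    (r : List Symbol) :
    Exec readFormula
      (st (post.flatMap fun i => encodeClause (φ.get i)) r [] []
        (tally pre.length) [] [] [] [])
      (post.length * (12 * B + 2) + 1)
      (st [] (((post.flatMap clauseOccs).flatMap (occRecord φ)).reverse ++ r) [] []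
        (tally φ.length) [] [] [] []) := by
  induction post generalizing pre r with
  | nil =>
    have hlen : φ.length = pre.length := by
      have := congrArg List.length h
      simpa using this
    refine ((Exec.loop_done rfl).congr ?_).weaken (by simp)
    have ht : tally pre.length = tally φ.length := congrArg tally hlen.symm
    rw [ht]; rfl
  | cons i post ih =>
    have hi := val_eq_length_of_finRange h
    set D := post.flatMap fun i => encodeClause (φ.get i) with hD
    have e0 := exec_literalStep hB (i, 0) (encodeLiteral (occLiteral φ (i, 1)) ++
      (encodeLiteral (occLiteral φ (i, 2)) ++ D)) r
    have e1 := exec_literalStep hB (i, 1) (encodeLiteral (occLiteral φ (i, 2)) ++ D)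
      ((occRecord φ (i, 0)).reverse ++ r)
    have e2 := exec_literalStep hB (i, 2) D
      ((occRecord φ (i, 1)).reverse ++ ((occRecord φ (i, 0)).reverse ++ r))
    have e3 : Exec (.push Stk.I (.bit true)) _ 1
        (st D ((occRecord φ (i, 2)).reverse ++ ((occRecord φ (i, 1)).reverse ++
          ((occRecord φ (i, 0)).reverse ++ r))) [] [] (tally (pre ++ [i]).length) [] [] [] []) :=
      (Exec.push Stk.I (.bit true)
        (st D ((occRecord φ (i, 2)).reverse ++ ((occRecord φ (i, 1)).reverse ++
          ((occRecord φ (i, 0)).reverse ++ r))) [] [] (tally i) [] [] [] [])).congr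
        (by rw [List.length_append, ← hi]; funext k; cases k <;> rfl)
    have e4 := ih (pre := pre ++ [i]) (by simp [h]) ((occRecord φ (i, 2)).reverse ++
      ((occRecord φ (i, 1)).reverse ++ ((occRecord φ (i, 0)).reverse ++ r)))
    have e5 := Exec.loop_step (k := Stk.D) (k' := Stk.D) (c := fun o _ => o.isSome) rfl
      (e0.seq (e1.seq (e2.seq e3))) e4
    rw [← hi]
    have hDi : ((i :: post).flatMap fun i => encodeClause (φ.get i)) =
        encodeLiteral (occLiteral φ (i, 0)) ++ (encodeLiteral (occLiteral φ (i, 1)) ++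
      (encodeLiteral (occLiteral φ (i, 2)) ++ D)) := by
      rw [List.flatMap_cons, ← hD, encodeClause]
      simp only [List.append_assoc]
      rfl
    rw [hDi]
    refine (e5.congr ?_).weaken ?_
    · simp [clauseOccs]
    · rw [List.length_cons, Nat.add_mul (post.length) 1]; omega

theorem exec_readFormula {B : ℕ} (hB : ∀ o, (occRecord φ o).length ≤ B) :
    Exec readFormula (st (φ.flatMap encodeClause) [] [] [] [] [] [] [] [])
      (φ.length * (12 * B + 2) + 1)
      (st [] ((occs φ.length).flatMap (occRecord φ)).reverse [] [] (tally φ.length)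
        [] [] [] []) := by
  have := exec_readFormula_aux hB (pre := []) (post := List.finRange φ.length) rfl []
  rw [← occs_eq, List.length_finRange, List.append_nil] at this
  have h2 : ((List.finRange φ.length).flatMap fun i => encodeClause (φ.get i)) =
      φ.flatMap encodeClause := by
    rw [← List.flatMap_map φ.get, List.map_get_finRange]
  rwa [h2] at this

end Formula

/-! ### Writing the elements -/

/-- For every clause counted by `k`, write the names of the elements with the given tags. -/
def namePass (tags : List Tag) (k k' : Stk) : Prog Stk :=
  .loop k k (fun o _ => o.isSome) <|
    .seq (.move k [k']) (emitNames (tags.map fun τ => (tagName τ, k)))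

/-- A counter is decremented before the names are written, so clause numbers appear in decreasing
order from `n - 1` to `0`; this is why `elemsAt` runs through the clauses backwards. -/
def tagNames (tags : List Tag) (n : ℕ) : List Symbol :=
  (List.range n).reverse.flatMap fun i =>
    tags.flatMap fun τ => encodeName (tagName τ ++ List.replicate i true)

/-- The count leaving `k` is collected on `k'`, so that the next pass can run with the roles
exchanged. -/
theorem exec_namePass (tags : List Tag) {k k' : Stk} (hkk' : k ≠ k') (hkO : k ≠ .O)
    (hkT : k ≠ .T) (hkO' : k' ≠ .O) (hkT' : k' ≠ .T) {n c M : ℕ} (hn : n ≤ M)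
    {s : Stacks Stk} (hk : s k = tally n) (hk' : s k' = tally c) (hT : s .T = []) :
    Exec (namePass tags k k') s (n * (tags.length * (4 * M + 11) + 3) + 1)
      (update (update (update s k []) k' (tally (n + c))) .O
        ((tagNames tags n).reverse ++ s .O)) := by
  induction n generalizing s c with
  | zero =>
    refine ((Exec.loop_done (by rw [hk]; rfl)).congr ?_).weaken (by simp)
    funext x
    by_cases hx : x = .O
    · subst hx; simp [tagNames]
    · by_cases hx' : x = k'
      · subst hx'; simp [hkO', hk']
      · by_cases hxk : x = k
        · subst hxk; simp [hkO, hkk', hk, tally, bitWord]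
        · simp [hx, hx', hxk]
  | succ n ih =>
    have h1 := exec_move (ks := [k']) (by simp) (by simpa using hkk')
      (hk.trans (tally_succ n))
    set s₁ := moveTo k [k'] [.bit true] (tally n) s with hs₁
    have hk₁ : s₁ k = tally n := by simp [s₁, moveTo]
    have hk₁' : s₁ k' = tally (c + 1) := by
      simp [s₁, moveTo, Ne.symm hkk', hk', tally_succ]
    have hT₁ : s₁ .T = [] := by simp [s₁, moveTo, Ne.symm hkT, Ne.symm hkT', hT]
    have hO₁ : s₁ .O = s .O := by simp [s₁, moveTo, Ne.symm hkO, Ne.symm hkO']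
    have h2 := exec_emitNames (tags.map fun τ => (tagName τ, k))
      (fun _ => List.replicate n true) (s := s₁) (B := 7 + 4 * M) (by
        intro e he
        obtain ⟨τ, -, rfl⟩ := List.mem_map.1 he
        refine ⟨hkO, hkT, hk₁, ?_⟩
        simp only [length_tagName, List.length_replicate]
        omega) hT₁
    have h3 := ih (c := c + 1) (by omega)
      (s := update s₁ .O (((tags.map fun τ => (tagName τ, k)).flatMap fun e =>
        encodeName (e.1 ++ List.replicate n true)).reverse ++ s₁ .O))
      (by rw [update_of_ne hkO, hk₁]) (by rw [update_of_ne hkO', hk₁'])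
      (by rw [update_of_ne (by decide), hT₁])
    have hc : ((fun o _ => o.isSome : Option Symbol → Option Symbol → Bool)
        (s k).head? (s k).head?) = true := by rw [hk]; rfl
    refine ((Exec.loop_step hc (h1.seq h2) h3).congr ?_).weaken ?_
    · funext x
      by_cases hx : x = .O
      · subst hx
        simp [tagNames, List.range_succ, List.flatMap_map, hO₁]
      · by_cases hx' : x = k'
        · subst hx'
          simp only [update_self, update_of_ne hkO']
          congr 1
          omega
        · by_cases hxk : x = k
          · subst hxk; simp [hkO, hkk']
          · simp [hx, hx', hxk, s₁, moveTo]
    · rw [List.length_map, Nat.add_mul n 1, show 7 + 4 * M + 4 = 4 * M + 11 by omega]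
      omega

theorem tagNames_tagsAt (m : ℕ) (k : Fin 3) :
    tagNames (tagsAt k) m = ((elemsAt m k).map elemName).flatMap encodeName := by
  have h : elemsAt m k = (List.finRange m).reverse.flatMap fun i =>
    (tagsAt k).map fun τ => (i, τ) := rfl
  have hr : List.range m = (List.finRange m).map Fin.val := by simp
  rw [tagNames, h, hr, ← List.map_reverse, List.flatMap_map, List.flatMap_map,
    List.flatMap_assoc]
  congr 1
  funext i
  rw [List.flatMap_map]
  rfl

/-! ### The complete reduction -/

def separator (b : Bool) : List Symbol := if b then [.semicolon] else []

def separate (b : Bool) : Prog Stk := if b then .push .O .semicolon else .skip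

theorem exec_separate (b : Bool) (d r t o i j n v s : List Symbol) :
    Exec (separate b) (st d r t o i j n v s) 1 (st d r t (separator b ++ o) i j n v s) := by
  cases b
  · exact .skip _
  · exact (Exec.push ..).congr (by funext k; cases k <;> rfl)

/-- Write an instance of 3-dimensional matching or of exact cover by 3-sets; only in the former
case the sets of elements are separated. -/
def reduction (b : Bool) : Prog Stk :=
  -- The three drains after reading leave two copies of the list of records on `D`, as the cyclic
  -- search requires. The three name passes shuttle the clause count from `I` to `J`, back, and to
  -- `J` again, where `triplePass` expects it. The final drains empty the stacks for the start of
  -- the next algorithm.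
  .seq readFormula <| .seq (drain .R [.D, .T]) <| .seq (drain .T [.R]) <|
  .seq (drain .R [.D]) <| .seq (namePass (tagsAt 0) .I .J) <| .seq (separate b) <|
  .seq (namePass (tagsAt 1) .J .I) <| .seq (separate b) <|
  .seq (namePass (tagsAt 2) .I .J) <| .seq (separate true) <| .seq triplePass <|
  .seq (drain .D []) (drain .I [])

def reductionTime (m B : ℕ) : ℕ :=
  (m * (12 * B + 2) + 1) + 3 * (2 * (m * 3 * B) + 1) + 3 * (m * (14 * (4 * m + 11) + 3) + 1) + 3 +
    (m * (3 * (6 * m * (7 * B + 11) + 142 * B + 380) + 2) + 1) + (2 * (m * 3 * B) + 1) +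
    (2 * m + 1)

section Formula

variable (φ : List Clause)

def elemNames (k : Fin 3) : List Name := (elemsAt φ.length k).map elemName

def reductionOutput (b : Bool) : List Symbol :=
  (elemNames φ 0).flatMap encodeName ++ separator b ++
    ((elemNames φ 1).flatMap encodeName ++ separator b) ++
    ((elemNames φ 2).flatMap encodeName ++ separator true) ++
    (tripleList (occNext φ) (occSign φ)).flatMap encodeTriple

variable {φ}

theorem exec_reduction (b : Bool) {B : ℕ} (hB : ∀ o, (occRecord φ o).length ≤ B) :
    Exec (reduction b) (st (φ.flatMap encodeClause) [] [] [] [] [] [] [] [])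
      (reductionTime φ.length B)
      (st [] [] [] (reductionOutput φ b).reverse [] [] [] [] []) := by
  set E := (occs φ.length).flatMap (occRecord φ) with hE
  have hlen : E.length ≤ φ.length * 3 * B := by
    rw [← length_occs]
    exact length_flatMap_le fun o _ => hB o
  have hlen' : E.reverse.length ≤ φ.length * 3 * B := by rwa [List.length_reverse]
  have h1 := exec_readFormula hB
  have h2 : Exec (drain Stk.R [.D, .T]) (st [] E.reverse [] [] (tally φ.length) [] [] [] [])
      (2 * (φ.length * 3 * B) + 1) (st E [] E [] (tally φ.length) [] [] [] []) :=
    ((exec_drain (k := Stk.R) (ks := [.D, .T]) (by decide) (by decide) rfl).weaken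
      (Nat.add_le_add_right (Nat.mul_le_mul_left 2 hlen') 1)).congr
      (by funext k; cases k <;> simp [moveTo, st])
  have h3 : Exec (drain Stk.T [.R]) (st E [] E [] (tally φ.length) [] [] [] [])
      (2 * (φ.length * 3 * B) + 1) (st E E.reverse [] [] (tally φ.length) [] [] [] []) :=
    ((exec_drain (k := Stk.T) (ks := [.R]) (by decide) (by decide) rfl).weaken
      (Nat.add_le_add_right (Nat.mul_le_mul_left 2 hlen) 1)).congr
      (by funext k; cases k <;> simp [moveTo, st])
  have h4 : Exec (drain Stk.R [.D]) (st E E.reverse [] [] (tally φ.length) [] [] [] [])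
      (2 * (φ.length * 3 * B) + 1) (st (E ++ E) [] [] [] (tally φ.length) [] [] [] []) :=
    ((exec_drain (k := Stk.R) (ks := [.D]) (by decide) (by decide) rfl).weaken
      (Nat.add_le_add_right (Nat.mul_le_mul_left 2 hlen') 1)).congr
      (by funext k; cases k <;> simp [moveTo, st])
  have hIJ : ∀ (k : Fin 3) (o : List Symbol), Exec (namePass (tagsAt k) .I .J)
      (st (E ++ E) [] [] o (tally φ.length) [] [] [] []) (φ.length * (14 * (4 * φ.length + 11) + 3) + 1)
      (st (E ++ E) [] [] (((elemNames φ k).flatMap encodeName).reverse ++ o) [] (tally φ.length)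
        [] [] []) := fun k o => by
    have h := exec_namePass (tagsAt k) (k := .I) (k' := .J) (by decide) (by decide) (by decide)
      (by decide) (by decide) (le_refl _) (c := 0)
      (s := st (E ++ E) [] [] o (tally φ.length) [] [] [] []) rfl rfl rfl
    rw [length_tagsAt, tagNames_tagsAt] at h
    exact h.congr (by funext k; cases k <;> rfl)
  have hJI : ∀ (k : Fin 3) (o : List Symbol), Exec (namePass (tagsAt k) .J .I)
      (st (E ++ E) [] [] o [] (tally φ.length) [] [] []) (φ.length * (14 * (4 * φ.length + 11) + 3) + 1)
      (st (E ++ E) [] [] (((elemNames φ k).flatMap encodeName).reverse ++ o) (tally φ.length) []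
        [] [] []) := fun k o => by
    have h := exec_namePass (tagsAt k) (k := .J) (k' := .I) (by decide) (by decide) (by decide)
      (by decide) (by decide) (le_refl _) (c := 0)
      (s := st (E ++ E) [] [] o [] (tally φ.length) [] [] []) rfl rfl rfl
    rw [length_tagsAt, tagNames_tagsAt] at h
    exact h.congr (by funext k; cases k <;> rfl)
  have h5 := fun o => exec_triplePass hB (φ := φ) o
  rw [List.flatMap_append] at h5
  have h6 : ∀ o, Exec (drain Stk.D []) (st E [] [] o (tally φ.length) [] [] [] [])
      (2 * (φ.length * 3 * B) + 1) (st [] [] [] o (tally φ.length) [] [] [] []) := fun o =>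
    ((exec_drain (k := Stk.D) (ks := []) (by decide) (by decide) rfl).weaken
      (Nat.add_le_add_right (Nat.mul_le_mul_left 2 hlen) 1)).congr
      (by funext k; cases k <;> rfl)
  have h7 : ∀ o, Exec (drain Stk.I []) (st [] [] [] o (tally φ.length) [] [] [] [])
      (2 * φ.length + 1) (st [] [] [] o [] [] [] [] []) := fun o =>
    ((exec_drain (k := Stk.I) (ks := []) (by decide) (by decide) (l := tally φ.length) rfl).weaken
      (by simp [tally, bitWord])).congr (by funext k; cases k <;> rfl)
  refine ((h1.seq <| h2.seq <| h3.seq <| h4.seq <| (hIJ 0 _).seq <|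
    (exec_separate b _ _ _ _ _ _ _ _ _).seq <| (hJI 1 _).seq <|
    (exec_separate b _ _ _ _ _ _ _ _ _).seq <| (hIJ 2 _).seq <|
    (exec_separate true _ _ _ _ _ _ _ _ _).seq <| (h5 _).seq <| (h6 _).seq (h7 _)).congr
    ?_).weaken ?_
  · have ht : (tripleList (occNext φ) (occSign φ)).flatMap encodeTriple =
        (occs φ.length).flatMap (occTriples φ) := by
      have h : labels φ.length = (occs φ.length).flatMap fun o => gadgets.map fun g => (o, g) := rfl
      rw [tripleList, h, List.flatMap_map, List.flatMap_assoc]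
      congr 1
    have hs : ∀ b, (separator b).reverse = separator b := by decide
    congr 1
    rw [reductionOutput, ht]
    simp [hs]
  · unfold reductionTime
    omega

theorem length_encodeName_elemName_le {m : ℕ} (e : Elem m) :
    (encodeName (elemName e)).length ≤ m + 8 := by
  have := e.1.isLt
  simp [encodeName, elemName, length_tagName]
  omega

/-- There are `3 * 14` elements per clause and `33` triples of three names each, so `42 + 99 = 141`
names per clause, each of length at most `φ.length + 8`, and at most three separators. -/
theorem length_reductionOutput_le (b : Bool) :
    (reductionOutput φ b).length ≤ 141 * φ.length * (φ.length + 8) + 3 := by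
  have hE : ∀ k, ((elemNames φ k).flatMap encodeName).length ≤
      14 * φ.length * (φ.length + 8) := fun k => by
    refine (length_flatMap_le (B := φ.length + 8) ?_).trans_eq ?_
    · intro w hw
      obtain ⟨e, -, rfl⟩ := List.mem_map.1 hw
      exact length_encodeName_elemName_le e
    · rw [elemNames, List.length_map, length_elemsAt]; ring
  have hM : ((tripleList (occNext φ) (occSign φ)).flatMap encodeTriple).length ≤
      33 * φ.length * (3 * (φ.length + 8)) := by
    refine (length_flatMap_le (B := 3 * (φ.length + 8)) ?_).trans_eq ?_
    · intro t ht
      obtain ⟨l, -, rfl⟩ := List.mem_map.1 ht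
      have h1 := length_encodeName_elemName_le (labelTriple (occNext φ) (occSign φ) l).1
      have h2 := length_encodeName_elemName_le (labelTriple (occNext φ) (occSign φ) l).2.1
      have h3 := length_encodeName_elemName_le (labelTriple (occNext φ) (occSign φ) l).2.2
      simp only [encodeTriple, nameTriple, List.length_append]
      omega
    · rw [tripleList, List.length_map, length_labels]
  have hs : ∀ b, (separator b).length ≤ 1 := by decide
  have h0 := hE 0
  have h1 := hE 1
  have h2 := hE 2
  have hb := hs b
  have ht := hs true
  simp only [reductionOutput, List.length_append]
  nlinarith

theorem length_le_length_encode : φ.length ≤ (φ.flatMap encodeClause).length := by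
  rw [List.length_flatMap]
  refine le_trans (by simp) (List.card_nsmul_le_sum (φ.map fun c => (encodeClause c).length) 1 ?_)
  intro n hn
  obtain ⟨c, -, rfl⟩ := List.mem_map.1 hn
  simp [encodeClause, encodeLiteral, encodeName]

theorem length_occRecord_le (o : Occ φ.length) :
    (occRecord φ o).length ≤ 2 * (φ.flatMap encodeClause).length + 5 := by
  have h1 := length_le_length_encode (φ := φ)
  have h2 := o.1.isLt
  have h3 : (occLiteral φ o).var.length ≤ (encodeClause (φ.get o.1)).length := by
    have hr : ∀ q : Fin 3, q = 0 ∨ q = 1 ∨ q = 2 := by decide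
    obtain ⟨i, q⟩ := o
    rcases hr q with rfl | rfl | rfl <;>
      simp [occLiteral, Clause.literal, encodeClause, encodeLiteral, encodeName] <;> omega
  have h4 : (encodeClause (φ.get o.1)).length ≤ (φ.flatMap encodeClause).length := by
    rw [List.length_flatMap]
    exact List.single_le_sum (by simp) _ (List.mem_map_of_mem (List.get_mem φ o.1))
  rw [length_occRecord]
  omega

end Formula

/-! ### Complexity: subexponential algorithms pull back along the reduction. -/

/-! ### Transfer of running times -/

theorem eval_mono_nat (p : Polynomial ℕ) {a b : ℕ} (h : a ≤ b) : p.eval a ≤ p.eval b := by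
  rw [Polynomial.eval_eq_sum, Polynomial.eval_eq_sum]
  exact Finset.sum_le_sum fun i _ => Nat.mul_le_mul_left _ (Nat.pow_le_pow_left h i)

theorem exists_reductionTime_polynomial :
    ∃ p : Polynomial ℕ, ∀ n, p.eval n = reductionTime n (2 * n + 5) := by
  let X : Polynomial ℕ := Polynomial.X
  let B : Polynomial ℕ := 2 * X + 5
  refine ⟨(X * (12 * B + 2) + 1) + 3 * (2 * (X * 3 * B) + 1) +
    3 * (X * (14 * (4 * X + 11) + 3) + 1) + 3 +
    (X * (3 * (6 * X * (7 * B + 11) + 142 * B + 380) + 2) + 1) + (2 * (X * 3 * B) + 1) +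
    (2 * X + 1), fun n => ?_⟩
  simp [reductionTime, X, B]

theorem reductionTime_mono {m n B : ℕ} (h : m ≤ n) : reductionTime m B ≤ reductionTime n B := by
  unfold reductionTime
  gcongr

/-- A problem to which satisfiability is reduced by `reduction b` has no faster algorithms. -/
theorem decidableInSubexpTime_of_reduction (P : DecisionProblem) (b : Bool)
    (inst : List Clause → P.Instance) (hyes : ∀ φ, threeSAT.IsYes φ ↔ P.IsYes (inst φ))
    (hsize : ∀ φ, P.size (inst φ) = 33 * φ.length)
    (hencode : ∀ φ, P.encode (inst φ) = reductionOutput φ b)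
    (h : P.DecidableInSubexpTime) : threeSAT.DecidableInSubexpTime := by
  obtain ⟨A, f, p, hf, hA⟩ := h
  obtain ⟨q, hq⟩ := exists_reductionTime_polynomial
  let Q : Polynomial ℕ := 141 * Polynomial.X * (Polynomial.X + 8) + 3
  -- The absolute value makes the exponential factor at least `1`, so that it also absorbs the
  -- polynomial cost of the reduction. The polynomial adds the time of the program (`q`), of the
  -- transfer (`Q + 1`, where `Q` bounds the output length), and the polynomial factor of `A` on the
  -- output.
  refine ⟨precompose A (reduction b) .D .O, fun m => |f (33 * m)|, q + (Q + 1) + p.comp Q, ?_,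
    ?_⟩
  · refine Asymptotics.IsLittleO.abs_left ?_
    have h1 := hf.comp_tendsto (k := fun m : ℕ => 33 * m)
      (Filter.tendsto_id.const_mul_atTop' (by norm_num))
    refine h1.trans_isBigO ?_
    refine Asymptotics.IsBigO.of_bound 33 (Filter.Eventually.of_forall fun m => ?_)
    simp
  · intro (φ : List Clause)
    obtain ⟨a, t, hans, ht, hrun⟩ := hA (inst φ)
    simp only [hsize, hencode] at hrun ht
    have hexec := exec_reduction b (length_occRecord_le (φ := φ))
    have hin : st (φ.flatMap encodeClause) [] [] [] [] [] [] [] [] =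
        update (fun _ => []) Stk.D (φ.flatMap encodeClause) := by
      funext k; cases k <;> rfl
    have hout : st [] [] [] (reductionOutput φ b).reverse [] [] [] [] [] =
        update (fun _ => []) Stk.O (reductionOutput φ b).reverse := by
      funext k; cases k <;> rfl
    rw [hin, hout] at hexec
    refine ⟨a, _, hans.trans (hyes φ).symm, ?_, answersWithin_precompose hexec hrun⟩
    set n := (φ.flatMap encodeClause).length with hn
    have hmn : φ.length ≤ n := length_le_length_encode
    have hQ : (reductionOutput φ b).length ≤ Q.eval n := by
      refine (length_reductionOutput_le b).trans ?_
      simp only [Q, Polynomial.eval_add, Polynomial.eval_mul, Polynomial.eval_ofNat,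
        Polynomial.eval_X]
      gcongr
    have hT : reductionTime φ.length (2 * n + 5) ≤ q.eval n := by
      rw [hq]; exact reductionTime_mono hmn
    have hpQ : p.eval (reductionOutput φ b).length ≤ p.eval (Q.eval n) := eval_mono_nat p hQ
    have hone : (1 : ℝ) ≤ 2 ^ |f (33 * φ.length)| :=
      Real.one_le_rpow (by norm_num) (abs_nonneg _)
    have hle : (2 : ℝ) ^ f (33 * φ.length) ≤ 2 ^ |f (33 * φ.length)| :=
      Real.rpow_le_rpow_of_exponent_le (by norm_num) (le_abs_self _)
    have h1 : ((reductionTime φ.length (2 * n + 5) + ((reductionOutput φ b).length + 1) : ℕ) : ℝ) ≤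
        2 ^ |f (33 * φ.length)| * ((q.eval n + (Q.eval n + 1) : ℕ) : ℝ) := by
      refine le_trans (Nat.cast_le.2 (by omega)) (le_mul_of_one_le_left (Nat.cast_nonneg _) hone)
    have h2 : (t : ℝ) ≤ 2 ^ |f (33 * φ.length)| * ((p.eval (Q.eval n) : ℕ) : ℝ) := by
      refine ht.trans ?_
      gcongr
    have h3 : (q + (Q + 1) + p.comp Q).eval n =
        (q.eval n + (Q.eval n + 1)) + p.eval (Q.eval n) := by
      simp [Polynomial.eval_comp]
    show ((_ : ℕ) : ℝ) ≤ 2 ^ |f (33 * φ.length)| *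
      (((q + (Q + 1) + p.comp Q).eval n : ℕ) : ℝ)
    rw [h3, Nat.cast_add, Nat.cast_add (q.eval n + (Q.eval n + 1)), mul_add]
    exact add_le_add h1 h2

end SubexpTime

/-! ### The two hardness statements. -/

open SubexpTime

theorem mainTheorem3 :
    SubexpTime.ExponentialTimeHypothesis →
      ¬ SubexpTime.threeDM.DecidableInSubexpTime ∧
      ¬ SubexpTime.exactCoverBy3Sets.DecidableInSubexpTime := by
  refine fun hETH => ⟨fun h => hETH ?_, fun h => hETH ?_⟩
  · refine decidableInSubexpTime_of_reduction threeDM true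
      (fun φ => matchingInstance (occNext φ) (occSign φ)) (fun φ => ?_) (fun φ => ?_)
      (fun φ => ?_) h
    · exact (isYes_iff_exists_isCover φ).trans (hasPerfectMatching_iff _ _).symm
    · exact (List.length_map _).trans (length_labels _)
    · rfl
  · refine decidableInSubexpTime_of_reduction exactCoverBy3Sets false
      (fun φ => coverInstance (occNext φ) (occSign φ)) (fun φ => ?_) (fun φ => ?_)
      (fun φ => ?_) h
    · exact (isYes_iff_exists_isCover φ).trans (hasExactCover_iff _ _).symm
    · exact (List.length_map _).trans (length_labels _)
    · show encodeNames ((elemsAt _ 0 ++ elemsAt _ 1 ++ elemsAt _ 2).map elemName) ++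
        (tripleList (occNext φ) (occSign φ)).flatMap encodeTriple = _
      simp [encodeNames, reductionOutput, elemNames, separator]
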